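/- An operator system is a complex $*$-vector space $\mathcal S$ with cones $M_n(\mathcal S)^+$ of Hermitian elements of $M_n(\mathcal S)$ ($n\in\mathbb N$) such that $M_n(\mathcal S)^+\cap(-M_n(\mathcal S)^+)=\{0\}$ and $\alpha M_n(\mathcal S)^+\alpha^*\subseteq M_m(\mathcal S)^+$ for every complex $m\times n$ matrix $\alpha$, together with an element $1_{\mathcal S}$ that is an Archimedean matrix order unit (for every $n$ and every Hermitian $X\in M_n(\mathcal S)$, one has $rI_n\otimes 1_{\mathcal S}+X\in M_n(\mathcal S)^+$ for some $r>0$; and if this holds for all $r>0$, then $X\in M_n(\mathcal S)^+$). A linear map $\varphi$ between operator systems is unital completely positive (ucp) if it maps unit to unit and, applied entrywise, maps the cone of $n\times n$ matrices into the cone of $n\times n$ matrices for every $n$. Matrix algebras $M_k=M_k(\mathbb C)$ carry the cones $M_n(M_k)^+=M_{nk}^+$ of positive semidefinite matrices, and finite direct sums the componentwise cones. For operator systems $\mathcal S,\mathcal T$ let $M_n(\mathcal S\otimes_{\min}\mathcal T)^+$ be the set of $[p_{ij}]\in M_n(\mathcal S\otimes\mathcal T)$ such that $[(\varphi\otimes\psi)(p_{ij})]\in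 M_{nkm}^+$ for all $k,m$ and all ucp maps $\varphi:\mathcal S\to M_k$, $\psi:\mathcal T\to M_m$. Let $D_n$ be the set of all $\alpha(P\otimes Q)\alpha^*$ with $P\in M_k(\mathcal S)^+$, $Q\in M_l(\mathcal T)^+$, $\alpha$ a complex $n\times kl$ matrix, $k,l\in\mathbb N$, and let $M_n(\mathcal S\otimes_{\max}\mathcal T)^+$ be the set of $X\in M_n(\mathcal S\otimes\mathcal T)$ such that $X+\varepsilon I_n\otimes 1_{\mathcal S}\otimes 1_{\mathcal T}\in D_n$ for all $\varepsilon>0$. Call $\mathcal S$ nuclear if $M_n(\mathcal S\otimes_{\min}\mathcal T)^+=M_n(\mathcal S\otimes_{\max}\mathcal T)^+$ for every operator system $\mathcal T$ and every $n$. Corollary. Let $\mathcal S$ be a finite-dimensional nuclear operator system. Then $\mathcal S$ is unitally completely order isomorphic to a direct sum of matrix algebras: there are $d\ge 0$, integers $k_1,\dots,k_d\ge 1$ and a linear bijection $f:\mathcal S\to M_{k_1}\oplus\dots\oplus M_{k_d}$ such that $f$ and $f^{-1}$ are unital completely positive. -/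

import Mathlib

open scoped TensorProduct ComplexOrder

universe u v w

/-- For a scalar matrix `a` and a square matrix `X` with entries in a complex vector space,
the matrix `a X a*`. -/
def matrixCompress {S : Type u} [AddCommGroup S] [Module ℂ S] {m n : Type*} [Fintype n]
    (a : Matrix m n ℂ) (X : Matrix n n S) : Matrix m m S :=
  Matrix.of fun i j => ∑ k, ∑ l, (a i k * star (a j l)) • X k l

/-- An (abstract) operator system structure on a complex `*`-vector space `S`: a matrix
ordering, i.e. a compatible family of proper cones `cone n` of Hermitian elements of `M_n(S)`,
and a distinguished element `unit` which is an Archimedean matrix order unit. -/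
class OperatorSystem (S : Type u) [AddCommGroup S] [Module ℂ S] [StarAddMonoid S]
    [StarModule ℂ S] where
  cone : (n : ℕ) → Set (Matrix (Fin n) (Fin n) S)
  unit : S
  isHermitian_of_mem : ∀ {n : ℕ} {X : Matrix (Fin n) (Fin n) S}, X ∈ cone n → X.IsHermitian
  add_mem : ∀ {n : ℕ} {X Y : Matrix (Fin n) (Fin n) S},
    X ∈ cone n → Y ∈ cone n → X + Y ∈ cone n
  smul_mem : ∀ {n : ℕ} {t : ℝ} {X : Matrix (Fin n) (Fin n) S},
    0 ≤ t → X ∈ cone n → (t : ℂ) • X ∈ cone n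
  eq_zero_of_mem_of_neg_mem : ∀ {n : ℕ} {X : Matrix (Fin n) (Fin n) S},
    X ∈ cone n → -X ∈ cone n → X = 0
  compress_mem : ∀ {m n : ℕ} (a : Matrix (Fin m) (Fin n) ℂ) {X : Matrix (Fin n) (Fin n) S},
    X ∈ cone n → matrixCompress a X ∈ cone m
  exists_smul_unit_add_mem : ∀ {n : ℕ} {X : Matrix (Fin n) (Fin n) S}, X.IsHermitian →
    ∃ r : ℝ, 0 < r ∧ (r : ℂ) • Matrix.diagonal (fun _ => unit) + X ∈ cone n
  mem_of_forall_smul_unit_add_mem : ∀ {n : ℕ} {X : Matrix (Fin n) (Fin n) S}, X.IsHermitian →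
    (∀ r : ℝ, 0 < r → (r : ℂ) • Matrix.diagonal (fun _ => unit) + X ∈ cone n) → X ∈ cone n

namespace OperatorSystem

section Matrices

variable {m n k : ℕ}

theorem comp_matrixCompress (a : Matrix (Fin m) (Fin n) ℂ)
    (X : Matrix (Fin n) (Fin n) (Matrix (Fin k) (Fin k) ℂ)) :
    Matrix.comp _ _ _ _ ℂ (matrixCompress a X) =
      Matrix.kroneckerMap (· * ·) a (1 : Matrix (Fin k) (Fin k) ℂ) * Matrix.comp _ _ _ _ ℂ X *
        (Matrix.kroneckerMap (· * ·) a (1 : Matrix (Fin k) (Fin k) ℂ)).conjTranspose := by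
  ext ⟨i, p⟩ ⟨j, q⟩
  simp only [Matrix.comp_apply, matrixCompress, Matrix.of_apply, Matrix.mul_apply,
    Matrix.sum_apply, Matrix.smul_apply, Matrix.conjTranspose_apply, Matrix.kroneckerMap_apply,
    Fintype.sum_prod_type, Matrix.one_apply, mul_ite, mul_one, mul_zero, ite_mul, zero_mul,
    Finset.sum_ite_eq, Finset.mem_univ, if_true, apply_ite star, star_zero, smul_eq_mul,
    Finset.sum_mul]
  rw [Finset.sum_comm]
  refine Finset.sum_congr rfl fun x _ => Finset.sum_congr rfl fun y _ => ?_
  ring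

theorem comp_diagonal_one :
    Matrix.comp (Fin n) (Fin n) (Fin k) (Fin k) ℂ (Matrix.diagonal fun _ => 1) = 1 := by
  ext ⟨i, p⟩ ⟨j, q⟩
  by_cases h : i = j <;> simp [Matrix.comp_apply, Matrix.diagonal, Matrix.one_apply, h]

theorem isHermitian_comp {X : Matrix (Fin n) (Fin n) (Matrix (Fin k) (Fin k) ℂ)} :
    (Matrix.comp _ _ _ _ ℂ X).IsHermitian ↔ X.IsHermitian := by
  constructor
  · intro h
    ext i j p q
    exact congrFun (congrFun h (i, p)) (j, q)
  · intro h
    ext ⟨i, p⟩ ⟨j, q⟩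
    exact congrFun (congrFun (congrFun (congrFun h i) j) p) q

open scoped Matrix.Norms.L2Operator MatrixOrder in
theorem exists_smul_one_add_posSemidef {ι : Type*} [Fintype ι] [DecidableEq ι]
    {M : Matrix ι ι ℂ} (hM : M.IsHermitian) :
    ∃ r : ℝ, 0 < r ∧ ((r : ℂ) • (1 : Matrix ι ι ℂ) + M).PosSemidef := by
  refine ⟨‖M‖ + 1, by positivity, ?_⟩
  have h1 : -(algebraMap ℝ (Matrix ι ι ℂ)) ‖M‖ ≤ M :=
    IsSelfAdjoint.neg_algebraMap_norm_le_self (a := M) hM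
  have h2 : 0 ≤ algebraMap ℝ (Matrix ι ι ℂ) ‖M‖ + M := by
    rwa [neg_le_iff_add_nonneg'] at h1
  have h3 : (algebraMap ℝ (Matrix ι ι ℂ) ‖M‖ + M + 1).PosSemidef :=
    (Matrix.nonneg_iff_posSemidef.1 h2).add Matrix.PosSemidef.one
  convert h3 using 1
  rw [Algebra.algebraMap_eq_smul_one, Complex.ofReal_add, add_smul, Complex.ofReal_one, one_smul,
    Complex.coe_smul]
  abel

theorem posSemidef_of_forall_smul_one_add {ι : Type*} [Fintype ι] [DecidableEq ι]
    {M : Matrix ι ι ℂ} (hM : M.IsHermitian)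
    (h : ∀ r : ℝ, 0 < r → ((r : ℂ) • (1 : Matrix ι ι ℂ) + M).PosSemidef) : M.PosSemidef := by
  refine Matrix.PosSemidef.of_dotProduct_mulVec_nonneg hM fun x => ?_
  have hc : Filter.Tendsto
      (fun r : ℝ => dotProduct (star x) (((r : ℂ) • (1 : Matrix ι ι ℂ) + M).mulVec x))
      (nhdsWithin 0 (Set.Ioi 0)) (nhds (dotProduct (star x) (M.mulVec x))) := by
    have : Continuous
        (fun r : ℝ => dotProduct (star x) (((r : ℂ) • (1 : Matrix ι ι ℂ) + M).mulVec x)) := by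
      simp only [Matrix.add_mulVec, Matrix.smul_mulVec, Matrix.one_mulVec, dotProduct_add,
        dotProduct_smul]
      fun_prop
    have h0 := this.tendsto 0
    simp only [Complex.ofReal_zero, zero_smul, zero_add] at h0
    exact h0.mono_left nhdsWithin_le_nhds
  refine ge_of_tendsto hc ?_
  filter_upwards [self_mem_nhdsWithin] with r hr
  exact (h r hr).dotProduct_mulVec_nonneg x

open scoped MatrixOrder in
theorem eq_zero_of_posSemidef_of_neg {ι : Type*} [Fintype ι] {M : Matrix ι ι ℂ}
    (h : M.PosSemidef) (h' : (-M).PosSemidef) : M = 0 :=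
  le_antisymm (neg_nonneg.1 (Matrix.nonneg_iff_posSemidef.2 h'))
    (Matrix.nonneg_iff_posSemidef.2 h)

end Matrices

/-- The matrix algebra `M_k` with its canonical operator system structure: a matrix in
`M_n(M_k) = M_{nk}` is in the cone iff it is positive semidefinite. -/
noncomputable instance instMatrix (k : ℕ) : OperatorSystem (Matrix (Fin k) (Fin k) ℂ) where
  cone n := {X | (Matrix.comp (Fin n) (Fin n) (Fin k) (Fin k) ℂ X).PosSemidef}
  unit := 1
  isHermitian_of_mem h := isHermitian_comp.1 h.isHermitian
  add_mem hX hY := Matrix.PosSemidef.add hX hY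
  smul_mem ht hX := Matrix.PosSemidef.smul hX (Complex.zero_le_real.2 ht)
  eq_zero_of_mem_of_neg_mem {n X} hX hX' :=
    (Matrix.comp (Fin n) (Fin n) (Fin k) (Fin k) ℂ).injective
      (eq_zero_of_posSemidef_of_neg (ι := Fin n × Fin k) hX hX')
  compress_mem a X hX := by
    rw [Set.mem_ofPred_eq, comp_matrixCompress]
    exact Matrix.PosSemidef.mul_mul_conjTranspose_same hX _
  exists_smul_unit_add_mem {n X} hX := by
    obtain ⟨r, hr, h⟩ := exists_smul_one_add_posSemidef (isHermitian_comp.2 hX)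
    refine ⟨r, hr, ?_⟩
    rw [← comp_diagonal_one] at h
    exact h
  mem_of_forall_smul_unit_add_mem {n X} hX h := by
    refine posSemidef_of_forall_smul_one_add (isHermitian_comp.2 hX) fun r hr => ?_
    rw [← comp_diagonal_one]
    exact h r hr

/-- The direct sum of finitely many operator systems, with componentwise matrix cones. -/
noncomputable instance instPi {ι : Type v} [Finite ι] (S : ι → Type u) [∀ i, AddCommGroup (S i)]
    [∀ i, Module ℂ (S i)] [∀ i, StarAddMonoid (S i)] [∀ i, StarModule ℂ (S i)]
    [∀ i, OperatorSystem (S i)] : OperatorSystem (∀ i, S i) where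
  cone n := {X | ∀ i, X.map (fun s => s i) ∈ cone n}
  unit := fun _ => unit
  isHermitian_of_mem {n X} h := by
    ext p q i
    exact congrFun (congrFun (isHermitian_of_mem (h i)) p) q
  add_mem hX hY i := add_mem (hX i) (hY i)
  smul_mem ht hX i := smul_mem ht (hX i)
  eq_zero_of_mem_of_neg_mem hX hX' := by
    ext p q i
    exact congrFun (congrFun (eq_zero_of_mem_of_neg_mem (hX i) (hX' i)) p) q
  compress_mem a X hX i := by
    convert compress_mem a (hX i) using 1
    ext p q
    simp [matrixCompress]
  exists_smul_unit_add_mem {n X} hX := by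
    have hXi : ∀ i, (X.map (fun s => s i)).IsHermitian := fun i => by
      ext p q
      exact congrFun (congrFun (congrFun hX p) q) i
    choose r hr hr' using fun i => exists_smul_unit_add_mem (hXi i)
    have := Fintype.ofFinite ι
    refine ⟨1 + ∑ i, r i, add_pos_of_pos_of_nonneg one_pos
      (Finset.sum_nonneg fun i _ => (hr i).le), fun i => ?_⟩
    obtain ⟨s, hs, hs'⟩ := exists_smul_unit_add_mem (S := S i) (n := n) (X := 0)
      Matrix.isHermitian_zero
    rw [add_zero] at hs'
    have h1 : (Matrix.diagonal (fun _ => unit) : Matrix (Fin n) (Fin n) (S i)) ∈ cone n := by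
      have := smul_mem (inv_nonneg.2 hs.le) hs'
      rwa [smul_smul, ← Complex.ofReal_mul, inv_mul_cancel₀ hs.ne', Complex.ofReal_one,
        one_smul] at this
    have h2 : 0 ≤ 1 + ∑ j, r j - r i := by
      have := Finset.single_le_sum (fun j _ => (hr j).le) (Finset.mem_univ i)
      linarith
    convert add_mem (smul_mem h2 h1) (hr' i) using 1
    rw [← add_assoc, ← add_smul, ← Complex.ofReal_add, sub_add_cancel]
    ext p q
    by_cases hpq : p = q <;> simp [Matrix.diagonal, hpq]
  mem_of_forall_smul_unit_add_mem {n X} hX h i := by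
    refine mem_of_forall_smul_unit_add_mem ?_ fun r hr => ?_
    · ext p q
      exact congrFun (congrFun (congrFun hX p) q) i
    · convert h r hr i using 1
      ext p q
      by_cases hpq : p = q <;> simp [Matrix.diagonal, hpq]

section Maps

variable {S : Type u} [AddCommGroup S] [Module ℂ S] [StarAddMonoid S] [StarModule ℂ S]
  [OperatorSystem S]
variable {T : Type v} [AddCommGroup T] [Module ℂ T] [StarAddMonoid T] [StarModule ℂ T]
  [OperatorSystem T]

/-- A linear map between operator systems is unital completely positive. -/
structure IsUCP (φ : S →ₗ[ℂ] T) : Prop where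
  map_unit : φ unit = unit
  map_mem_cone : ∀ (n : ℕ) (X : Matrix (Fin n) (Fin n) S), X ∈ cone n → X.map φ ∈ cone n

variable (S T) in
/-- `S` and `T` are unitally completely order isomorphic: there is a linear bijection which is
unital completely positive, with unital completely positive inverse. -/
def UnitallyCompletelyOrderIsomorphic : Prop :=
  ∃ f : S ≃ₗ[ℂ] T, IsUCP (f : S →ₗ[ℂ] T) ∧ IsUCP (f.symm : T →ₗ[ℂ] S)

/-- For linear maps `φ : S → M_k` and `ψ : T → M_m`, the linear map
`φ ⊗ ψ : S ⊗ T → M_k ⊗ M_m = M_{km}`, given by Kronecker products. -/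
noncomputable def tensorToMatrix {k m : ℕ} (φ : S →ₗ[ℂ] Matrix (Fin k) (Fin k) ℂ)
    (ψ : T →ₗ[ℂ] Matrix (Fin m) (Fin m) ℂ) :
    S ⊗[ℂ] T →ₗ[ℂ] Matrix (Fin k × Fin m) (Fin k × Fin m) ℂ :=
  TensorProduct.lift ((Matrix.kroneckerBilinear (R := ℂ) (α := ℂ)).compl₁₂ φ ψ)

variable (S T)

/-- The cone `M_n(S ⊗_min T)^+`. -/
def minCone (n : ℕ) : Set (Matrix (Fin n) (Fin n) (S ⊗[ℂ] T)) :=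
  {X | ∀ (k m : ℕ) (φ : S →ₗ[ℂ] Matrix (Fin k) (Fin k) ℂ) (ψ : T →ₗ[ℂ] Matrix (Fin m) (Fin m) ℂ),
    IsUCP φ → IsUCP ψ →
      (Matrix.comp (Fin n) (Fin n) (Fin k × Fin m) (Fin k × Fin m) ℂ
        (X.map (tensorToMatrix φ ψ))).PosSemidef}

/-- The set `D_n^max(S, T)` of all `α (P ⊗ Q) α*` with `P ∈ M_k(S)^+`, `Q ∈ M_l(T)^+` and
`α` a scalar `n × kl` matrix. -/
def maxPreCone (n : ℕ) : Set (Matrix (Fin n) (Fin n) (S ⊗[ℂ] T)) :=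
  {X | ∃ (k l : ℕ) (P : Matrix (Fin k) (Fin k) S) (Q : Matrix (Fin l) (Fin l) T)
    (α : Matrix (Fin n) (Fin k × Fin l) ℂ), P ∈ cone k ∧ Q ∈ cone l ∧
      X = matrixCompress α (Matrix.kroneckerMap (fun s t => s ⊗ₜ[ℂ] t) P Q)}

/-- The cone `M_n(S ⊗_max T)^+`, the Archimedeanization of `D_n^max(S, T)`. -/
def maxCone (n : ℕ) : Set (Matrix (Fin n) (Fin n) (S ⊗[ℂ] T)) :=
  {X | ∀ ε : ℝ, 0 < ε →
    X + (ε : ℂ) • Matrix.diagonal (fun _ => (unit : S) ⊗ₜ[ℂ] (unit : T)) ∈ maxPreCone S T n}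

end Maps

/-- An operator system is nuclear if its minimal and maximal tensor products with every operator
system coincide, i.e. have the same matrix cones. -/
def IsNuclear (S : Type u) [AddCommGroup S] [Module ℂ S] [StarAddMonoid S] [StarModule ℂ S]
    [OperatorSystem S] : Prop :=
  ∀ (T : Type u) [AddCommGroup T] [Module ℂ T] [StarAddMonoid T] [StarModule ℂ T]
    [OperatorSystem T] (n : ℕ), minCone S T n = maxCone S T n

end OperatorSystem

/-! Nuclearity is tested against a single partner, the dual of `S`. In finite dimension `S` carries
a positive functional `δ` that dominates every functional on the matrix cones, and `δ` is an
Archimedean matrix order unit for the dual cones (`dualOperatorSystem`). The canonical tensor of the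
identity of `S` lies in the minimal cone of `S` with its dual: a ucp map on the dual is a positive
matrix over `S`, by the bipolar theorem `mem_cone_iff`. Nuclearity puts this tensor in the maximal
cone. Unravelling `α (P ⊗ Q) α*`, the matrix `Q` becomes a cp map from `S` to `M_l`, and `P` with
`α` becomes a cp map back. Their composite is `x + ε δ(x) 1` (`IsNuclear.exists_factorization`).

Once the first legs are made unital, take errors tending to zero. The first legs assemble to a map
`φ` from `S` into the `*`-algebra of bounded sequences of matrices, and an ultralimit of the second
legs gives `ψ` with `ψ ∘ φ = id` (`IsNuclear.exists_isCPRetract`).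

By the Choi–Effros argument `ψ (φ s * φ t)` is then an associative product on `S`, compatible with
the star. The functional `δ` is positive and faithful for it, so the algebra is semisimple.
Wedderburn's theorem splits it into matrix blocks, and `δ` serves again to correct the isomorphism
so that it respects stars (`exists_star_algEquiv_pi_matrix`). The matrix order is recovered because
positivity, in `S` as in the blocks, is governed by Gram matrices and compressions. -/

/-- An algebraic Hahn–Banach separation theorem for a convex cone with an order unit `e`. -/
theorem exists_nonneg_functional_neg {E : Type*} [AddCommGroup E] [Module ℝ E] (C : Set E)
    (hadd : ∀ x ∈ C, ∀ y ∈ C, x + y ∈ C) (hsmul : ∀ t : ℝ, 0 ≤ t → ∀ x ∈ C, t • x ∈ C)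
    (e : E) (he : e ∈ C) (hunit : ∀ y, ∃ r : ℝ, r • e + y ∈ C) (x : E)
    (hx : ∃ r : ℝ, 0 < r ∧ r • e + x ∉ C) :
    ∃ g : E →ₗ[ℝ] ℝ, (∀ y ∈ C, 0 ≤ g y) ∧ g x < 0 := by
  obtain ⟨r, hr, hrx⟩ := hx
  obtain ⟨z, hz⟩ : ∃ z, z = r • e + x := ⟨_, rfl⟩
  rw [← hz] at hrx
  have h0 : (0 : E) ∈ C := by simpa using hsmul 0 le_rfl _ he
  -- If `-e` were in `C`, the order unit property would make `C` contain `z`.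
  have hneg : -e ∉ C := by
    intro h
    obtain ⟨s, hs⟩ := hunit z
    rcases le_total 0 s with hs0 | hs0
    · have := hadd _ (hsmul s hs0 _ h) _ hs
      rw [smul_neg, neg_add_cancel_left] at this
      exact hrx this
    · have := hadd _ (hsmul (-s) (by linarith) _ he) _ hs
      rw [neg_smul, neg_add_cancel_left] at this
      exact hrx this
  have he0 : e ≠ 0 := fun h => hneg (by rw [h, neg_zero]; exact h0)
  have hnegt : ∀ t : ℝ, t • e ∈ C → 0 ≤ t := by
    intro t ht
    by_contra! h
    have := hsmul (-t)⁻¹ (inv_nonneg.2 (by linarith)) _ ht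
    rw [smul_smul, inv_neg, neg_mul, inv_mul_cancel₀ h.ne, neg_smul, one_smul] at this
    exact hneg this
  -- The cone generated by `C` and `-z`. A functional nonnegative on it with value 1 at `e`
  -- satisfies `g z ≤ 0`, that is `g x ≤ -r < 0`.
  let C₂ : PointedCone ℝ E :=
    { carrier := {y | ∃ l : ℝ, 0 ≤ l ∧ y + l • z ∈ C}
      add_mem' := by
        rintro a b ⟨l, hl, h⟩ ⟨l', hl', h'⟩
        refine ⟨l + l', by positivity, ?_⟩
        convert hadd _ h _ h' using 1
        module
      zero_mem' := ⟨0, le_rfl, by simpa using h0⟩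
      smul_mem' := by
        rintro c a ⟨l, hl, h⟩
        refine ⟨c * l, mul_nonneg c.2 hl, ?_⟩
        convert hsmul c c.2 _ h using 1
        change (c : ℝ) • a + _ = _
        module }
  obtain ⟨g, hg, hgC⟩ := riesz_extension C₂ (LinearPMap.mkSpanSingleton e (1 : ℝ) he0) (by
    rintro ⟨y, hy⟩ ⟨l, hl, h⟩
    obtain ⟨t, rfl⟩ := Submodule.mem_span_singleton.1 hy
    erw [LinearPMap.mkSpanSingleton'_apply]
    rw [smul_eq_mul, mul_one, RingHom.id_apply]
    rcases hl.eq_or_lt with rfl | hl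
    · exact hnegt t (by simpa using h)
    · by_contra! ht
      have h1 := hadd _ (hsmul (-t) (by linarith) _ he) _ h
      simp only [neg_smul, neg_add_cancel_left] at h1
      have h2 := hsmul l⁻¹ (inv_nonneg.2 hl.le) _ h1
      rw [smul_smul, inv_mul_cancel₀ hl.ne', one_smul] at h2
      exact hrx h2) (by
    intro y
    obtain ⟨s, hs⟩ := hunit y
    exact ⟨⟨s • e, Submodule.smul_mem _ _ (Submodule.mem_span_singleton_self e)⟩, 0, le_rfl,
      by simpa using hs⟩)
  have hge : g e = 1 := by
    have := hg ⟨(1 : ℝ) • e, Submodule.smul_mem _ _ (Submodule.mem_span_singleton_self e)⟩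
    erw [LinearPMap.mkSpanSingleton'_apply] at this
    simpa using this
  refine ⟨g, fun y hy => hgC y ⟨0, le_rfl, by simpa using hy⟩, ?_⟩
  have := hgC (-z) ⟨1, zero_le_one, by simpa using h0⟩
  rw [hz, map_neg, map_add, map_smul, hge, smul_eq_mul] at this
  linarith

/-! ### Functionals on matrices over `S` and the bipolar theorem -/

namespace OperatorSystem

theorem isHermitian_add_conjTranspose {S : Type u} [AddCommGroup S] [StarAddMonoid S] {n : ℕ}
    (X : Matrix (Fin n) (Fin n) S) :
    (X + X.conjTranspose).IsHermitian := by
  rw [Matrix.IsHermitian, Matrix.conjTranspose_add, Matrix.conjTranspose_conjTranspose, add_comm]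

theorem exists_isHermitian_add {S : Type u} [AddCommGroup S] [Module ℂ S] [StarAddMonoid S]
    [StarModule ℂ S] {n : ℕ} (X : Matrix (Fin n) (Fin n) S) :
    ∃ A B : Matrix (Fin n) (Fin n) S, A.IsHermitian ∧ B.IsHermitian ∧ X = A + Complex.I • B := by
  refine ⟨(2⁻¹ : ℂ) • (X + X.conjTranspose), (2⁻¹ : ℂ) • ((-Complex.I) • X +
    ((-Complex.I) • X).conjTranspose), ?_, ?_, ?_⟩
  · rw [Matrix.IsHermitian, Matrix.conjTranspose_smul, isHermitian_add_conjTranspose]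
    simp
  · rw [Matrix.IsHermitian, Matrix.conjTranspose_smul, isHermitian_add_conjTranspose]
    simp
  · rw [Matrix.conjTranspose_smul]
    have : star (-Complex.I) = Complex.I := by simp
    rw [this, smul_smul, smul_add, smul_add, smul_smul, smul_smul]
    have h1 : Complex.I * 2⁻¹ * -Complex.I = 2⁻¹ := by
      linear_combination (-2⁻¹ : ℂ) * Complex.I_mul_I
    have h2 : Complex.I * 2⁻¹ * Complex.I = -2⁻¹ := by
      linear_combination (2⁻¹ : ℂ) * Complex.I_mul_I
    rw [h1, h2]
    module

section Pairing

variable {S : Type u} [AddCommGroup S] [Module ℂ S] {n : ℕ}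

/-- Evaluation of a functional on `M_n(S)` at a matrix, in coordinates. -/
def pairing (F : Matrix (Fin n) (Fin n) (Module.Dual ℂ S)) : Matrix (Fin n) (Fin n) S →ₗ[ℂ] ℂ :=
  ∑ i, ∑ j, F i j ∘ₗ Matrix.entryLinearMap ℂ S i j

theorem pairing_apply (F : Matrix (Fin n) (Fin n) (Module.Dual ℂ S)) (X : Matrix (Fin n) (Fin n) S) :
    pairing F X = ∑ i, ∑ j, F i j (X i j) := by
  simp [pairing]

theorem pairing_single (F : Matrix (Fin n) (Fin n) (Module.Dual ℂ S)) (i j : Fin n) (s : S) :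
    pairing F (Matrix.single i j s) = F i j s := by
  rw [pairing_apply, Finset.sum_eq_single i, Finset.sum_eq_single j, Matrix.single_apply_same]
  · intro b _ hb
    rw [Matrix.single_apply_of_col_ne _ _ hb.symm, map_zero]
  · simp
  · intro b _ hb
    refine Finset.sum_eq_zero fun c _ => ?_
    rw [Matrix.single_apply_of_row_ne hb.symm, map_zero]
  · simp

theorem exists_eq_pairing (L : Matrix (Fin n) (Fin n) S →ₗ[ℂ] ℂ) :
    ∃ F : Matrix (Fin n) (Fin n) (Module.Dual ℂ S), L = pairing F := by
  refine ⟨Matrix.of fun i j => L ∘ₗ Matrix.singleLinearMap ℂ i j, LinearMap.ext fun X => ?_⟩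
  rw [pairing_apply]
  conv_lhs => rw [Matrix.matrix_eq_sum_single X]
  simp

end Pairing

variable {S : Type u} [AddCommGroup S] [Module ℂ S] [StarAddMonoid S] [StarModule ℂ S]
  [OperatorSystem S] {n m : ℕ}

theorem diagonal_unit_mem : (Matrix.diagonal (fun _ => unit) : Matrix (Fin n) (Fin n) S) ∈ cone n := by
  obtain ⟨s, hs, hs'⟩ := exists_smul_unit_add_mem (S := S) (n := n) (X := 0)
    Matrix.isHermitian_zero
  rw [add_zero] at hs'
  have := smul_mem (inv_nonneg.2 hs.le) hs'
  rwa [smul_smul, ← Complex.ofReal_mul, inv_mul_cancel₀ hs.ne', Complex.ofReal_one,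
    one_smul] at this

theorem zero_mem : (0 : Matrix (Fin n) (Fin n) S) ∈ cone n := by
  simpa using smul_mem (S := S) le_rfl (diagonal_unit_mem (n := n))

theorem sum_mem {ι : Type*} (s : Finset ι) (X : ι → Matrix (Fin n) (Fin n) S)
    (h : ∀ i ∈ s, X i ∈ cone n) : ∑ i ∈ s, X i ∈ cone n :=
  Finset.sum_induction X (· ∈ cone n) (fun _ _ => add_mem) zero_mem h

theorem mem_span_cone_of_isHermitian {X : Matrix (Fin n) (Fin n) S} (h : X.IsHermitian) :
    X ∈ Submodule.span ℂ (cone n : Set (Matrix (Fin n) (Fin n) S)) := by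
  obtain ⟨r, -, hr⟩ := exists_smul_unit_add_mem h
  have := Submodule.sub_mem _ (Submodule.subset_span hr)
    (Submodule.smul_mem _ (r : ℂ) (Submodule.subset_span (R := ℂ) (diagonal_unit_mem (S := S) (n := n))))
  rwa [add_sub_cancel_left] at this

theorem span_cone : Submodule.span ℂ (cone n : Set (Matrix (Fin n) (Fin n) S)) = ⊤ := by
  refine eq_top_iff.2 fun X _ => ?_
  obtain ⟨A, B, hA, hB, rfl⟩ := exists_isHermitian_add X
  exact Submodule.add_mem _ (mem_span_cone_of_isHermitian hA)
    (Submodule.smul_mem _ _ (mem_span_cone_of_isHermitian hB))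

/-- Nonnegative values are real, the cone spans, and both sides are conjugate-linear in `X`. -/
theorem eq_conj_of_nonneg (L : Matrix (Fin n) (Fin n) S →ₗ[ℂ] ℂ) (hL : ∀ X ∈ cone n, 0 ≤ L X)
    (X : Matrix (Fin n) (Fin n) S) : L X.conjTranspose = star (L X) := by
  have hX : X ∈ Submodule.span ℂ (cone n : Set (Matrix (Fin n) (Fin n) S)) := by
    rw [span_cone]; trivial
  induction hX using Submodule.span_induction with
  | mem X h =>
    rw [(isHermitian_of_mem h).eq]
    exact (IsSelfAdjoint.of_nonneg (hL X h)).star_eq.symm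
  | zero => simp
  | add X Y _ _ hX hY => rw [Matrix.conjTranspose_add, map_add, hX, hY, map_add, star_add]
  | smul c X _ hX => rw [Matrix.conjTranspose_smul, map_smul, map_smul, hX, smul_eq_mul, smul_eq_mul,
      star_mul']

variable (S) in
/-- The matrices over the dual space that are positive as functionals on `M_n(S)`. -/
def dualCone (n : ℕ) : Set (Matrix (Fin n) (Fin n) (Module.Dual ℂ S)) :=
  {F | ∀ X ∈ cone n, 0 ≤ pairing F X}

/-- Separation is done over the reals with the enlarged cone `C`, which contains every
anti-Hermitian matrix and its negative. The separating functional therefore vanishes on those, so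
its complexification is real, hence nonnegative, on `cone n`. -/
theorem exists_nonneg_re_neg {X : Matrix (Fin n) (Fin n) S} (hX : X.IsHermitian)
    (hXC : X ∉ cone n) : ∃ F ∈ dualCone S n, (pairing F X).re < 0 := by
  have hX2 : ∃ r : ℝ, 0 < r ∧ (r : ℂ) • Matrix.diagonal (fun _ => unit) + X ∉ cone n := by
    by_contra! h
    exact hXC (mem_of_forall_smul_unit_add_mem hX h)
  let C : Set (Matrix (Fin n) (Fin n) S) := {Y | Y + Y.conjTranspose ∈ cone n}
  have hdouble : ∀ Y : Matrix (Fin n) (Fin n) S, Y.IsHermitian → (Y ∈ C ↔ Y ∈ cone n) := by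
    intro Y hY
    change Y + Y.conjTranspose ∈ cone n ↔ _
    rw [hY.eq]
    refine ⟨fun h => ?_, fun h => add_mem h h⟩
    have := smul_mem (t := 2⁻¹) (by norm_num) h
    convert this using 1
    push_cast
    module
  have hd : (Matrix.diagonal (fun _ => unit) : Matrix (Fin n) (Fin n) S).IsHermitian :=
    isHermitian_of_mem diagonal_unit_mem
  have hherm : ∀ (r : ℝ) (Y : Matrix (Fin n) (Fin n) S), Y.IsHermitian → (r • Y).IsHermitian := by
    intro r Y hY
    rw [← Complex.coe_smul, Matrix.IsHermitian, Matrix.conjTranspose_smul, hY.eq]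
    simp
  obtain ⟨g, hg, hgX⟩ := exists_nonneg_functional_neg C
    (fun x hx y hy => by
      change _ ∈ cone n
      convert add_mem hx hy using 1
      rw [Matrix.conjTranspose_add]
      abel)
    (fun t ht x hx => by
      change _ ∈ cone n
      convert smul_mem ht hx using 1
      rw [← Complex.coe_smul, Matrix.conjTranspose_smul, smul_add]
      simp)
    (Matrix.diagonal fun _ => unit) ((hdouble _ hd).2 diagonal_unit_mem)
    (fun y => by
      obtain ⟨r, -, hr⟩ := exists_smul_unit_add_mem (isHermitian_add_conjTranspose y)
      refine ⟨2⁻¹ * r, ?_⟩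
      change _ ∈ cone n
      convert hr using 1
      rw [Matrix.conjTranspose_add, (hherm _ _ hd).eq, ← Complex.coe_smul]
      push_cast
      module) X
    (by
      obtain ⟨r, hr, h⟩ := hX2
      refine ⟨r, hr, fun h' => h ?_⟩
      rw [hdouble _ ((hherm _ _ hd).add hX)] at h'
      simpa [Complex.coe_smul] using h')
  obtain ⟨F, hF⟩ := exists_eq_pairing (Module.Dual.extendRCLike (𝕜 := ℂ) g)
  refine ⟨F, fun Y hY => ?_, ?_⟩
  · have hY' := isHermitian_of_mem hY
    rw [← hF, Complex.nonneg_iff]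
    have h0 : (0 : Matrix (Fin n) (Fin n) S) ∈ cone n := zero_mem
    have hI : (Complex.I • Y).conjTranspose = -(Complex.I • Y) := by
      rw [Matrix.conjTranspose_smul, hY'.eq]
      simp
    have h1 : Complex.I • Y ∈ C := by
      change _ ∈ cone n
      rw [hI, add_neg_cancel]
      exact h0
    have h2 : -(Complex.I • Y) ∈ C := by
      change _ ∈ cone n
      rw [Matrix.conjTranspose_neg, hI, add_neg_cancel]
      exact h0
    have h3 := hg _ h1
    have h4 := hg _ h2
    rw [map_neg] at h4
    refine ⟨?_, ?_⟩
    · have := Module.Dual.re_extendRCLike_apply (𝕜 := ℂ) g Y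
      simp only [RCLike.re_to_complex] at this
      rw [this]
      exact hg _ ((hdouble _ hY').2 hY)
    · have := Module.Dual.im_extendRCLike_apply (𝕜 := ℂ) g Y
      simp only [RCLike.im_to_complex, RCLike.I_to_complex] at this
      rw [this]
      linarith
  · rw [← hF]
    have := Module.Dual.re_extendRCLike_apply (𝕜 := ℂ) g X
    simp only [RCLike.re_to_complex] at this
    rwa [this]

/-- For Hermitian `X` this is separation. In general write `X = A + iB`: reality of all the pairings
kills those of `B`, so `B` and `-B` both lie in the cone and `B = 0`. -/
theorem mem_cone_iff {X : Matrix (Fin n) (Fin n) S} :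
    X ∈ cone n ↔ ∀ F ∈ dualCone S n, 0 ≤ pairing F X := by
  refine ⟨fun h F hF => hF X h, fun h => ?_⟩
  have key : ∀ Y : Matrix (Fin n) (Fin n) S, Y.IsHermitian →
      (∀ F ∈ dualCone S n, 0 ≤ pairing F Y) → Y ∈ cone n := by
    intro Y hY hF
    by_contra hYC
    obtain ⟨F, hF', hlt⟩ := exists_nonneg_re_neg hY hYC
    exact absurd (Complex.nonneg_iff.1 (hF F hF')).1 (not_le.2 hlt)
  obtain ⟨A, B, hA, hB, rfl⟩ := exists_isHermitian_add X
  have hz : ∀ F ∈ dualCone S n, pairing F B = 0 := by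
    intro F hF
    have hc := h F hF
    have h1 := eq_conj_of_nonneg (pairing F) hF A
    have h2 := eq_conj_of_nonneg (pairing F) hF B
    rw [hA.eq] at h1
    rw [hB.eq] at h2
    have h1' := congrArg Complex.im h1
    have h2' := congrArg Complex.im h2
    have h3 := (Complex.nonneg_iff.1 hc).2
    simp at h1' h2' h3
    apply Complex.ext <;> simp <;> linarith
  have hB0 : B = 0 := eq_zero_of_mem_of_neg_mem
    (key B hB fun F hF => by rw [hz F hF]) (key (-B) hB.neg fun F hF => by rw [map_neg, hz F hF, neg_zero])
  rw [hB0, smul_zero, add_zero] at h ⊢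
  exact key A hA h

end OperatorSystem

/-- Evaluate the form at `t e_i + c e_j`, with `c` a phase making `c * G i j` nonpositive. This form
of Cauchy–Schwarz, with `t` free, also covers vanishing diagonal entries. -/
theorem Matrix.PosSemidef.two_mul_norm_apply_le {ι : Type*} [Fintype ι] [DecidableEq ι]
    {G : Matrix ι ι ℂ} (hG : G.PosSemidef) (i j : ι) (t : ℝ) :
    2 * t * ‖G i j‖ ≤ t ^ 2 * (G i i).re + (G j j).re := by
  obtain ⟨c, hc, hcG⟩ : ∃ c : ℂ, ‖c‖ = 1 ∧ c * G i j = -(‖G i j‖ : ℂ) := by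
    by_cases h : G i j = 0
    · exact ⟨1, by simp, by simp [h]⟩
    · have hn : (‖G i j‖ : ℂ) ≠ 0 := by simpa using h
      refine ⟨-(star (G i j) / ‖G i j‖), ?_, ?_⟩
      · rw [norm_neg, norm_div, norm_star, Complex.norm_real, norm_norm, div_self]
        simpa using h
      · have := Complex.conj_mul' (G i j)
        rw [neg_mul, div_mul_eq_mul_div, RCLike.star_def, this, pow_two, mul_div_assoc, div_self hn,
          mul_one]
  have hji : G j i = star (G i j) := (hG.isHermitian.apply j i).symm
  have h := hG.dotProduct_mulVec_nonneg (Pi.single i (t : ℂ) + Pi.single j c)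
  have hcc : star c * c = 1 := by
    rw [RCLike.star_def, Complex.conj_mul', hc]; simp
  have hcG' : star c * G j i = -(‖G i j‖ : ℂ) := by
    rw [hji, ← star_mul', hcG]; simp
  have e : star (Pi.single i (t : ℂ) + Pi.single j c) ⬝ᵥ
      (G.mulVec (Pi.single i (t : ℂ) + Pi.single j c)) =
      t ^ 2 * G i i + t * (c * G i j) + t * (star c * G j i) + (star c * c) * G j j := by
    rw [star_add, Pi.star_single, Pi.star_single, Matrix.mulVec_add]
    simp [add_dotProduct, single_dotProduct, Matrix.mulVec_single]
    ring
  rw [e, hcG, hcG', hcc] at h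
  have := (Complex.nonneg_iff.1 h).1
  simp [← Complex.ofReal_pow] at this
  linarith

/-! ### Positive and dominating functionals -/

namespace OperatorSystem

variable {S : Type u} [AddCommGroup S] [Module ℂ S] [StarAddMonoid S] [StarModule ℂ S]
  [OperatorSystem S] {n m : ℕ}

/-- An element of an operator system is positive if it belongs to the cone at the first level. -/
def IsPos (s : S) : Prop := (Matrix.of fun _ _ => s : Matrix (Fin 1) (Fin 1) S) ∈ cone 1

theorem isPos_of_mem {X : Matrix (Fin n) (Fin n) S} (hX : X ∈ cone n) (v : Fin n → ℂ) :
    IsPos (∑ i, ∑ j, (star (v i) * v j) • X i j) := by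
  have := compress_mem (Matrix.of fun (_ : Fin 1) i => star (v i)) hX
  simpa [matrixCompress, IsPos] using this

theorem isPos_diag {X : Matrix (Fin n) (Fin n) S} (hX : X ∈ cone n) (k : Fin n) :
    IsPos (X k k) := by
  have := isPos_of_mem hX (Pi.single k 1)
  rw [Finset.sum_eq_single k, Finset.sum_eq_single k] at this
  · simpa using this
  · intro j _ hj; simp [hj]
  · simp
  · intro j _ hj; simp [hj]
  · simp

theorem isPos_unit : IsPos (unit : S) := by
  have := isPos_diag (diagonal_unit_mem (S := S) (n := 1)) 0
  simpa using this

theorem IsPos.add {s t : S} (hs : IsPos s) (ht : IsPos t) : IsPos (s + t) := add_mem hs ht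

theorem IsPos.smul {s : S} (hs : IsPos s) {t : ℝ} (ht : 0 ≤ t) : IsPos ((t : ℂ) • s) :=
  smul_mem ht hs

theorem IsPos.star_eq {s : S} (hs : IsPos s) : star s = s :=
  congrFun (congrFun (isHermitian_of_mem hs) 0) 0

theorem exists_isPos_smul_unit_add {s : S} (hs : star s = s) :
    ∃ r : ℝ, 0 < r ∧ IsPos ((r : ℂ) • unit + s) := by
  obtain ⟨r, hr, h⟩ := exists_smul_unit_add_mem (n := 1)
    (X := (Matrix.of fun _ _ => s : Matrix (Fin 1) (Fin 1) S)) (by ext; simp [hs])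
  refine ⟨r, hr, ?_⟩
  simpa using isPos_diag h 0

theorem span_isPos : Submodule.span ℂ {s : S | IsPos s} = ⊤ := by
  refine eq_top_iff.2 fun s _ => ?_
  have h : (Matrix.of fun _ _ => s : Matrix (Fin 1) (Fin 1) S) ∈
      Submodule.span ℂ (cone 1 : Set (Matrix (Fin 1) (Fin 1) S)) := by
    rw [span_cone]; trivial
  have := Submodule.mem_map_of_mem (f := Matrix.entryLinearMap ℂ S (0 : Fin 1) (0 : Fin 1)) h
  rw [Submodule.map_span] at this
  refine Submodule.span_mono ?_ this
  rintro _ ⟨X, hX, rfl⟩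
  exact isPos_diag hX 0

variable (S) in
/-- The positive linear functionals on an operator system. -/
def positiveFunctionals : Set (Module.Dual ℂ S) := {g | ∀ s, IsPos s → 0 ≤ g s}

theorem apply_zero_mem_positiveFunctionals {F : Matrix (Fin 1) (Fin 1) (Module.Dual ℂ S)}
    (hF : F ∈ dualCone S 1) : F 0 0 ∈ positiveFunctionals S := fun s hs => by
  simpa [pairing_apply] using hF _ hs

theorem eq_zero_of_forall_positiveFunctionals {s : S} (h : ∀ g ∈ positiveFunctionals S, g s = 0) :
    s = 0 := by
  have h1 : IsPos s := mem_cone_iff.2 fun F hF => by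
    simp [pairing_apply, h _ (apply_zero_mem_positiveFunctionals hF)]
  have h2 : IsPos (-s) := mem_cone_iff.2 fun F hF => by
    simp [pairing_apply, h _ (apply_zero_mem_positiveFunctionals hF)]
  exact congrFun (congrFun (eq_zero_of_mem_of_neg_mem h1 h2) 0) 0

theorem isPos_of_forall_positiveFunctionals {s : S} (h : ∀ g ∈ positiveFunctionals S, 0 ≤ g s) :
    IsPos s := mem_cone_iff.2 fun F hF => by
  simp [pairing_apply, h _ (apply_zero_mem_positiveFunctionals hF)]

theorem span_positiveFunctionals [FiniteDimensional ℂ S] :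
    Submodule.span ℂ (positiveFunctionals S) = ⊤ := by
  have h : (Submodule.span ℂ (positiveFunctionals S)).dualCoannihilator = ⊥ := by
    refine eq_bot_iff.2 fun s hs => ?_
    rw [Submodule.mem_dualCoannihilator] at hs
    exact eq_zero_of_forall_positiveFunctionals fun g hg => hs g (Submodule.subset_span hg)
  rw [← Subspace.dualCoannihilator_dualAnnihilator_eq (W := Submodule.span ℂ (positiveFunctionals S)), h,
    Submodule.dualAnnihilator_bot]

theorem positiveFunctional_star {g : Module.Dual ℂ S} (hg : g ∈ positiveFunctionals S) (s : S) :
    g (star s) = star (g s) := by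
  have hs : s ∈ Submodule.span ℂ {s : S | IsPos s} := by rw [span_isPos]; trivial
  induction hs using Submodule.span_induction with
  | mem s h => rw [h.star_eq, (IsSelfAdjoint.of_nonneg (hg s h)).star_eq]
  | zero => simp
  | add s t _ _ hs ht => rw [star_add, map_add, hs, ht, map_add, star_add]
  | smul c s _ hs => rw [star_smul, map_smul, map_smul, hs, smul_eq_mul, smul_eq_mul, star_mul']

theorem posSemidef_map_positiveFunctional {g : Module.Dual ℂ S} (hg : g ∈ positiveFunctionals S)
    {X : Matrix (Fin n) (Fin n) S} (hX : X ∈ cone n) : (X.map g).PosSemidef := by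
  refine Matrix.PosSemidef.of_dotProduct_mulVec_nonneg ?_ fun v => ?_
  · ext i j
    rw [Matrix.conjTranspose_apply, Matrix.map_apply, Matrix.map_apply, ← positiveFunctional_star hg]
    exact congrArg g (congrFun (congrFun (isHermitian_of_mem hX) i) j)
  · convert hg _ (isPos_of_mem hX v) using 1
    simp only [dotProduct, Matrix.mulVec, map_sum, map_smul, Finset.mul_sum, Pi.star_apply,
      Matrix.map_apply, smul_eq_mul]
    refine Finset.sum_congr rfl fun i _ => Finset.sum_congr rfl fun j _ => ?_
    ring

/-- A positive functional that dominates every functional on the matrix cones, up to a constant. -/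
def IsDominating (δ : Module.Dual ℂ S) : Prop :=
  δ ∈ positiveFunctionals S ∧ ∀ g : Module.Dual ℂ S, ∃ K : ℝ, 0 ≤ K ∧
    ∀ (n : ℕ) (X : Matrix (Fin n) (Fin n) S), X ∈ cone n → ∀ i j,
      ‖g (X i j)‖ ≤ K * ∑ k, (δ (X k k)).re

-- Positive functionals span the dual, so a basis can be chosen among them; `δ` is the sum of that
-- basis. Each basis element lies below `δ` on positive elements, and Cauchy–Schwarz carries the
-- bound to off-diagonal entries, uniformly in the matrix size.
variable (S) in
theorem exists_isDominating [FiniteDimensional ℂ S] : ∃ δ : Module.Dual ℂ S, IsDominating δ := by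
  obtain ⟨b, hbP, hb, hli⟩ := exists_linearIndependent ℂ (positiveFunctionals S)
  rw [span_positiveFunctionals] at hb
  have hfin : b.Finite := hli.setFinite
  have happ : ∀ s : S, (∑ h ∈ hfin.toFinset, h) s = ∑ h ∈ hfin.toFinset, h s := fun s => by
    simp
  refine ⟨∑ h ∈ hfin.toFinset, h, fun s hs => ?_, fun g => ?_⟩
  · rw [happ]
    exact Finset.sum_nonneg fun h hh => hbP (hfin.mem_toFinset.1 hh) s hs
  · have hg : g ∈ Submodule.span ℂ b := by rw [hb]; trivial
    induction hg using Submodule.span_induction with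
    | mem g hg =>
      refine ⟨1, zero_le_one, fun n X hX i j => ?_⟩
      have h1 := (posSemidef_map_positiveFunctional (hbP hg) hX).two_mul_norm_apply_le i j 1
      simp only [Matrix.map_apply] at h1
      have h2 : ∀ k, (g (X k k)).re ≤ ((∑ h ∈ hfin.toFinset, h) (X k k)).re := fun k => by
        rw [happ, Complex.re_sum]
        exact Finset.single_le_sum (f := fun h : Module.Dual ℂ S => (h (X k k)).re)
          (fun h hh => (Complex.nonneg_iff.1 (hbP (hfin.mem_toFinset.1 hh) _ (isPos_diag hX k))).1)
          (hfin.mem_toFinset.2 hg)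
      have h3 : ∀ k, (g (X k k)).re ≤ ∑ k, ((∑ h ∈ hfin.toFinset, h) (X k k)).re := fun k =>
        (Finset.single_le_sum (f := fun k => (g (X k k)).re)
          (fun k _ => (Complex.nonneg_iff.1 (hbP hg _ (isPos_diag hX k))).1)
          (Finset.mem_univ k)).trans (Finset.sum_le_sum fun k _ => h2 k)
      linarith [h3 i, h3 j]
    | zero => exact ⟨0, le_rfl, by simp⟩
    | add g g' _ _ hg hg' =>
      obtain ⟨K, hK, h⟩ := hg
      obtain ⟨K', hK', h'⟩ := hg'
      refine ⟨K + K', by positivity, fun n X hX i j => ?_⟩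
      rw [add_mul]
      exact (norm_add_le _ _).trans (add_le_add (h n X hX i j) (h' n X hX i j))
    | smul c g _ hg =>
      obtain ⟨K, hK, h⟩ := hg
      refine ⟨‖c‖ * K, by positivity, fun n X hX i j => ?_⟩
      rw [LinearMap.smul_apply, norm_smul, mul_assoc]
      exact mul_le_mul_of_nonneg_left (h n X hX i j) (norm_nonneg _)

theorem IsDominating.exists_bound {δ : Module.Dual ℂ S} (hδ : IsDominating δ) (g : Module.Dual ℂ S) :
    ∃ K : ℝ, 0 ≤ K ∧ ∀ s, IsPos s → ‖g s‖ ≤ K * (δ s).re := by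
  obtain ⟨K, hK, h⟩ := hδ.2 g
  exact ⟨K, hK, fun s hs => by simpa using h 1 _ hs 0 0⟩

theorem IsDominating.eq_zero {δ : Module.Dual ℂ S} (hδ : IsDominating δ) {s : S} (hs : IsPos s)
    (h : δ s = 0) : s = 0 :=
  eq_zero_of_forall_positiveFunctionals fun g _ => by
    obtain ⟨K, -, hK⟩ := hδ.exists_bound g
    simpa [h] using hK s hs

theorem eq_zero_of_diag_eq_zero {X : Matrix (Fin n) (Fin n) S} (hX : X ∈ cone n) {i j : Fin n}
    (h : X j j = 0) : X i j = 0 :=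
  eq_zero_of_forall_positiveFunctionals fun g hg => by
    have hP := (posSemidef_map_positiveFunctional hg hX).two_mul_norm_apply_le i j
    simp only [Matrix.map_apply, h, map_zero, Complex.zero_re, add_zero] at hP
    by_contra hne
    have hpos : 0 < ‖g (X i j)‖ := norm_pos_iff.2 hne
    set a := (g (X i i)).re
    -- Here `2t‖g (X i j)‖ ≤ t² a` for all real `t`; the chosen `t > 0` satisfies `t a ≤ ‖g (X i
    -- j)‖`, which is contradictory.
    have h1 := hP (‖g (X i j)‖ / (1 + |a|))
    have h2 : 0 < ‖g (X i j)‖ / (1 + |a|) := by positivity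
    have h3 : ‖g (X i j)‖ / (1 + |a|) * a ≤ ‖g (X i j)‖ := by
      rw [div_mul_eq_mul_div, div_le_iff₀ (by positivity)]
      exact mul_le_mul_of_nonneg_left (by linarith [le_abs_self a]) hpos.le
    nlinarith

theorem sum_sum_comm {ι κ M : Type*} [Fintype ι] [Fintype κ] [AddCommMonoid M]
    (f : ι → ι → κ → κ → M) : ∑ i, ∑ j, ∑ k, ∑ l, f i j k l = ∑ k, ∑ l, ∑ i, ∑ j, f i j k l := by
  have h := Finset.sum_comm (s := (Finset.univ : Finset (ι × ι))) (t := (Finset.univ : Finset (κ × κ)))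
    (f := fun x y => f x.1 x.2 y.1 y.2)
  simpa only [Fintype.sum_prod_type] using h

/-! ### The dual operator system -/

section Dual

variable {S : Type u} [AddCommGroup S] [Module ℂ S] {n m : ℕ}

theorem pairing_add (F G : Matrix (Fin n) (Fin n) (Module.Dual ℂ S)) (X : Matrix (Fin n) (Fin n) S) :
    pairing (F + G) X = pairing F X + pairing G X := by
  simp [pairing_apply, Finset.sum_add_distrib]

theorem pairing_smul (c : ℂ) (F : Matrix (Fin n) (Fin n) (Module.Dual ℂ S))
    (X : Matrix (Fin n) (Fin n) S) : pairing (c • F) X = c * pairing F X := by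
  simp [pairing_apply, Finset.mul_sum]

theorem pairing_neg (F : Matrix (Fin n) (Fin n) (Module.Dual ℂ S))
    (X : Matrix (Fin n) (Fin n) S) : pairing (-F) X = -pairing F X := by
  simp [pairing_apply]

theorem pairing_diagonal (δ : Module.Dual ℂ S) (X : Matrix (Fin n) (Fin n) S) :
    pairing (Matrix.diagonal fun _ => δ) X = ∑ i, δ (X i i) := by
  rw [pairing_apply]
  refine Finset.sum_congr rfl fun i _ => ?_
  rw [Finset.sum_eq_single i]
  · simp
  · intro j _ hj; simp [Matrix.diagonal_apply_ne _ hj.symm]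
  · simp

/-- The pairing is bilinear, not sesquilinear, so moving a compression across it produces the
transpose rather than the adjoint. -/
theorem pairing_matrixCompress (a : Matrix (Fin m) (Fin n) ℂ)
    (F : Matrix (Fin n) (Fin n) (Module.Dual ℂ S)) (X : Matrix (Fin m) (Fin m) S) :
    pairing (matrixCompress a F) X = pairing F (matrixCompress a.transpose X) := by
  simp only [pairing_apply, matrixCompress, Matrix.of_apply, LinearMap.sum_apply,
    LinearMap.smul_apply, map_sum, map_smul, Matrix.transpose_apply]
  rw [sum_sum_comm]

variable [StarAddMonoid S] [StarModule ℂ S]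

/-- The involution `f ↦ (s ↦ star (f (star s)))` on the dual of a complex `*`-vector space. -/
@[reducible]
noncomputable def dualStarAddMonoid : StarAddMonoid (Module.Dual ℂ S) where
  star f :=
    { toFun := fun s => star (f (star s))
      map_add' := fun s t => by rw [star_add, map_add, star_add]
      map_smul' := fun c s => by
        rw [star_smul, map_smul, smul_eq_mul, star_mul', star_star]
        rfl }
  star_involutive f := LinearMap.ext fun s => by
    change star (star (f (star (star s)))) = _
    rw [star_star, star_star]
  star_add f g := LinearMap.ext fun s => by
    change star ((f + g) (star s)) = star (f (star s)) + star (g (star s))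
    rw [LinearMap.add_apply, star_add]

attribute [local instance] dualStarAddMonoid

theorem dual_star_apply (f : Module.Dual ℂ S) (s : S) : (star f) s = star (f (star s)) := rfl

theorem dualStarModule : StarModule ℂ (Module.Dual ℂ S) where
  star_smul c f := LinearMap.ext fun s => by
    rw [dual_star_apply, LinearMap.smul_apply, LinearMap.smul_apply,
      dual_star_apply, smul_eq_mul, star_mul', smul_eq_mul]

attribute [local instance] dualStarModule

variable [OperatorSystem S]

/-- The dual operator system of a finite-dimensional operator system; the unit is a dominating
positive functional. -/
@[reducible]
noncomputable def dualOperatorSystem {δ : Module.Dual ℂ S} (hδ : IsDominating δ) :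
    OperatorSystem (Module.Dual ℂ S) where
  cone n := dualCone S n
  unit := δ
  isHermitian_of_mem {n F} hF := by
    ext i j s
    have h := eq_conj_of_nonneg (pairing F) hF (Matrix.single j i (star s))
    rw [Matrix.conjTranspose_single, star_star, pairing_single, pairing_single] at h
    exact h.symm
  add_mem {n F G} hF hG X hX := by
    rw [pairing_add]
    exact add_nonneg (hF X hX) (hG X hX)
  smul_mem {n t F} ht hF X hX := by
    rw [pairing_smul]
    exact mul_nonneg (Complex.zero_le_real.2 ht) (hF X hX)
  eq_zero_of_mem_of_neg_mem {n F} hF hF' := by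
    have hz : pairing F = 0 := by
      refine LinearMap.ext_on_range (v := fun X : (cone n : Set (Matrix (Fin n) (Fin n) S)) => X.1)
        (by simpa using span_cone) fun X => le_antisymm ?_ (hF X.1 X.2)
      have := hF' X.1 X.2
      rw [pairing_neg] at this
      exact neg_nonneg.1 this
    ext i j s
    rw [← pairing_single, hz, LinearMap.zero_apply, Matrix.zero_apply, LinearMap.zero_apply]
  compress_mem {m n} a F hF X hX := by
    rw [pairing_matrixCompress]
    exact hF _ (compress_mem a.transpose hX)
  exists_smul_unit_add_mem {n F} hF := by
    have hreal : ∀ X : Matrix (Fin n) (Fin n) S, X.IsHermitian → (pairing F X).im = 0 := by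
      intro X hX
      have : star (pairing F X) = pairing F X := by
        rw [pairing_apply, star_sum, Finset.sum_comm]
        refine Finset.sum_congr rfl fun j _ => ?_
        rw [star_sum]
        refine Finset.sum_congr rfl fun i _ => ?_
        rw [← hX.apply j i, ← hF.apply j i, dual_star_apply, star_star, star_star]
      have := congrArg Complex.im this
      simp at this
      linarith
    choose K hK hb using hδ.2
    -- Summing the domination bounds of the entries of `F` gives a constant valid for all positive
    -- `X` at once; the extra 1 only makes it strictly positive.
    refine ⟨1 + ∑ i, ∑ j, K (F i j), add_pos_of_pos_of_nonneg one_pos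
      (Finset.sum_nonneg fun i _ => Finset.sum_nonneg fun j _ => hK _), fun X hX => ?_⟩
    have hd : ∀ k, 0 ≤ δ (X k k) := fun k => hδ.1 _ (isPos_diag hX k)
    rw [pairing_add, pairing_smul, pairing_diagonal, Complex.nonneg_iff]
    have hD : (∑ k, δ (X k k)).im = 0 :=
      (Complex.nonneg_iff.1 (Finset.sum_nonneg fun k _ => hd k)).2.symm
    have hDr : 0 ≤ (∑ k, δ (X k k)).re :=
      (Complex.nonneg_iff.1 (Finset.sum_nonneg fun k _ => hd k)).1
    have hF : ‖pairing F X‖ ≤ (∑ i, ∑ j, K (F i j)) * (∑ k, δ (X k k)).re := by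
      rw [pairing_apply, Finset.sum_mul]
      refine (norm_sum_le _ _).trans (Finset.sum_le_sum fun i _ => ?_)
      rw [Finset.sum_mul]
      refine (norm_sum_le _ _).trans (Finset.sum_le_sum fun j _ => ?_)
      rw [Complex.re_sum]
      exact hb _ n X hX i j
    have := neg_le_of_abs_le ((Complex.abs_re_le_norm _).trans hF)
    rw [Complex.add_re, Complex.add_im, Complex.re_ofReal_mul, Complex.im_ofReal_mul, hD,
      hreal X (isHermitian_of_mem hX)]
    constructor
    · linarith
    · simp
  mem_of_forall_smul_unit_add_mem {n F} hF h X hX := by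
    have h' : ∀ r : ℝ, 0 < r → 0 ≤ (r : ℂ) * (∑ k, δ (X k k)) + pairing F X := by
      intro r hr
      have := h r hr X hX
      rwa [pairing_add, pairing_smul, pairing_diagonal] at this
    have ht : Filter.Tendsto (fun r : ℝ => (r : ℂ) * (∑ k, δ (X k k)) + pairing F X)
        (nhdsWithin 0 (Set.Ioi 0)) (nhds (pairing F X)) := by
      have hc : Continuous (fun r : ℝ => (r : ℂ) * (∑ k, δ (X k k)) + pairing F X) := by fun_prop
      have := hc.tendsto 0
      simp only [Complex.ofReal_zero, zero_mul, zero_add] at this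
      exact this.mono_left nhdsWithin_le_nhds
    refine ge_of_tendsto ht ?_
    filter_upwards [self_mem_nhdsWithin] with r hr using h' r hr

end Dual

end OperatorSystem

open scoped Matrix.Norms.L2Operator MatrixOrder in
theorem Matrix.PosSemidef.exists_eq_conjTranspose_mul_self {ι : Type*} [Fintype ι] [DecidableEq ι]
    {M : Matrix ι ι ℂ} (hM : M.PosSemidef) : ∃ B : Matrix ι ι ℂ, M = B.conjTranspose * B :=
  CStarAlgebra.nonneg_iff_eq_star_mul_self.1 hM.nonneg

theorem Matrix.PosDef.exists_isUnit_eq_conjTranspose_mul_self {ι : Type*} [Fintype ι] [DecidableEq ι]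
    {M : Matrix ι ι ℂ} (hM : M.PosDef) :
    ∃ B : Matrix ι ι ℂ, IsUnit B ∧ M = B.conjTranspose * B := by
  obtain ⟨B, rfl⟩ := hM.posSemidef.exists_eq_conjTranspose_mul_self
  refine ⟨B, ?_, rfl⟩
  have := (Matrix.isUnit_iff_isUnit_det _).1 hM.isUnit
  rw [Matrix.det_mul] at this
  exact (Matrix.isUnit_iff_isUnit_det _).2 (isUnit_of_mul_isUnit_right this)

namespace OperatorSystem

/-! ### Completely positive maps into and out of matrix algebras -/

section CP

variable {S : Type u} [AddCommGroup S] [Module ℂ S] [StarAddMonoid S] [StarModule ℂ S]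
  [OperatorSystem S]
variable {T : Type v} [AddCommGroup T] [Module ℂ T] [StarAddMonoid T] [StarModule ℂ T]
  [OperatorSystem T] {U : Type w} [AddCommGroup U] [Module ℂ U] [StarAddMonoid U] [StarModule ℂ U]
  [OperatorSystem U] {n m l : ℕ}

/-- A linear map between operator systems is completely positive. -/
def IsCP (φ : S →ₗ[ℂ] T) : Prop :=
  ∀ (n : ℕ) (X : Matrix (Fin n) (Fin n) S), X ∈ cone n → X.map φ ∈ cone n

theorem IsUCP.isCP {φ : S →ₗ[ℂ] T} (h : IsUCP φ) : IsCP φ := h.map_mem_cone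

theorem IsCP.comp {ψ : T →ₗ[ℂ] U} {φ : S →ₗ[ℂ] T} (hψ : IsCP ψ) (hφ : IsCP φ) :
    IsCP (ψ ∘ₗ φ) := fun n X hX => hψ n _ (hφ n X hX)

theorem IsCP.add {ψ φ : S →ₗ[ℂ] T} (hψ : IsCP ψ) (hφ : IsCP φ) : IsCP (ψ + φ) :=
  fun n X hX => add_mem (hψ n X hX) (hφ n X hX)

theorem IsCP.isPos {φ : S →ₗ[ℂ] T} (h : IsCP φ) {s : S} (hs : IsPos s) : IsPos (φ s) := h 1 _ hs

theorem IsCP.map_star {φ : S →ₗ[ℂ] T} (h : IsCP φ) (s : S) : φ (star s) = star (φ s) := by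
  have hs : s ∈ Submodule.span ℂ {s : S | IsPos s} := by rw [span_isPos]; trivial
  induction hs using Submodule.span_induction with
  | mem s hs => rw [hs.star_eq, (h.isPos hs).star_eq]
  | zero => simp
  | add s t _ _ hs ht => rw [star_add, map_add, hs, ht, map_add, star_add]
  | smul c s _ hs => rw [star_smul, map_smul, map_smul, hs, star_smul]

theorem mem_cone_matrix_iff {X : Matrix (Fin n) (Fin n) (Matrix (Fin l) (Fin l) ℂ)} :
    X ∈ cone n ↔ (Matrix.comp _ _ _ _ ℂ X).PosSemidef := Iff.rfl

theorem isPos_matrix_iff {M : Matrix (Fin l) (Fin l) ℂ} : IsPos M ↔ M.PosSemidef := by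
  have e : M = (Matrix.comp (Fin 1) (Fin 1) _ _ ℂ (Matrix.of fun _ _ => M)).submatrix
    (fun i => (0, i)) (fun i => (0, i)) := rfl
  refine ⟨fun h => ?_, fun h => ?_⟩
  · rw [e]
    exact Matrix.PosSemidef.submatrix h _
  · exact h.submatrix (fun x : Fin 1 × Fin l => x.2)

/-- A positive semidefinite block matrix is `B* B`, a sum of rank-one positive matrices given by the
rows of `B`, so these suffice as tests. -/
theorem isCP_of_vecMulVec (ψ : Matrix (Fin l) (Fin l) ℂ →ₗ[ℂ] S)
    (h : ∀ (n : ℕ) (v : Fin n → Fin l → ℂ),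
      (Matrix.of fun i j => ψ (Matrix.vecMulVec (star (v i)) (v j))) ∈ cone n) : IsCP ψ := by
  intro n X hX
  obtain ⟨B, hB⟩ := Matrix.PosSemidef.exists_eq_conjTranspose_mul_self (mem_cone_matrix_iff.1 hX)
  have e : X.map ψ = ∑ c, Matrix.of fun i j =>
      ψ (Matrix.vecMulVec (star fun p => B c (i, p)) (fun p => B c (j, p))) := by
    ext i j
    rw [Matrix.sum_apply]
    simp only [Matrix.of_apply, Matrix.map_apply]
    rw [← map_sum]
    congr 1
    ext p q
    have := congrFun (congrFun hB (i, p)) (j, q)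
    rw [Matrix.comp_apply] at this
    rw [this, Matrix.mul_apply, Matrix.sum_apply]
    rfl
  rw [e]
  exact sum_mem _ _ fun c _ => h n fun i p => B c (i, p)

theorem isCP_conj (B : Matrix (Fin l) (Fin l) ℂ) :
    IsCP (LinearMap.mulLeft ℂ B.conjTranspose ∘ₗ LinearMap.mulRight ℂ B) := by
  refine isCP_of_vecMulVec _ fun n v => ?_
  have e : ∀ i j, (LinearMap.mulLeft ℂ B.conjTranspose ∘ₗ LinearMap.mulRight ℂ B)
      (Matrix.vecMulVec (star (v i)) (v j)) =
      Matrix.vecMulVec (star (Matrix.vecMul (v i) B)) (Matrix.vecMul (v j) B) := fun i j => by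
    rw [LinearMap.comp_apply, LinearMap.mulRight_apply, LinearMap.mulLeft_apply,
      Matrix.vecMulVec_mul, Matrix.mul_vecMulVec, Matrix.star_vecMul]
  simp only [e]
  refine mem_cone_matrix_iff.2 ?_
  exact Matrix.posSemidef_vecMulVec_star_self fun x : Fin n × Fin l => Matrix.vecMul (v x.1) B x.2

theorem isCP_smulRight_one {g : Module.Dual ℂ S} (hg : g ∈ positiveFunctionals S) :
    IsCP (LinearMap.smulRight g (1 : Matrix (Fin l) (Fin l) ℂ)) := by
  intro n X hX
  have := (posSemidef_map_positiveFunctional hg hX).kronecker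
    (Matrix.PosSemidef.one (n := Fin l) (R := ℂ))
  exact this

/-- The linear map into a matrix algebra whose matrix entries are the given functionals. -/
def matrixOfDual (Q : Matrix (Fin l) (Fin l) (Module.Dual ℂ S)) : S →ₗ[ℂ] Matrix (Fin l) (Fin l) ℂ where
  toFun s := Matrix.of fun i j => Q i j s
  map_add' s t := by ext; simp
  map_smul' c s := by ext; simp

/-- The quadratic form at `v` of the image of `X` is `Q` paired with the compression of `X` by `v`,
reshaped as a matrix. -/
theorem isCP_matrixOfDual {Q : Matrix (Fin l) (Fin l) (Module.Dual ℂ S)} (hQ : Q ∈ dualCone S l) :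
    IsCP (matrixOfDual Q) := by
  intro n X hX
  have key : ∀ v : Fin n × Fin l → ℂ, 0 ≤ star v ⬝ᵥ
      (Matrix.comp _ _ _ _ ℂ (X.map (matrixOfDual Q))).mulVec v := fun v => by
    have h := hQ _ (compress_mem (Matrix.of fun j a => star (v (a, j))) hX)
    convert h using 1
    simp only [pairing_apply, matrixCompress, Matrix.of_apply, map_sum, map_smul, dotProduct,
      Matrix.mulVec, Fintype.sum_prod_type, Finset.mul_sum]
    rw [sum_sum_comm]
    refine Finset.sum_congr rfl fun i _ => ?_
    rw [Finset.sum_comm]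
    refine Finset.sum_congr rfl fun j _ => Finset.sum_congr rfl fun p _ =>
      Finset.sum_congr rfl fun q _ => ?_
    simp only [Pi.star_apply, star_star, smul_eq_mul, Matrix.comp_apply, Matrix.map_apply,
      matrixOfDual, LinearMap.coe_mk, AddHom.coe_mk, Matrix.of_apply]
    ring
  refine Matrix.PosSemidef.of_dotProduct_mulVec_nonneg ?_ key
  ext ⟨i, p⟩ ⟨j, q⟩
  have h := eq_conj_of_nonneg (pairing Q) hQ (Matrix.single q p (X j i))
  rw [Matrix.conjTranspose_single, pairing_single, pairing_single,
    (isHermitian_of_mem hX).apply i j] at h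
  exact h.symm

/-- The map `M ↦ ∑ α_a conj(α_b) M_{a₂ b₂} P_{a₁ b₁}` from a matrix algebra. -/
def ofMatrix {k : ℕ} (P : Matrix (Fin k) (Fin k) S) (α : Fin k × Fin l → ℂ) :
    Matrix (Fin l) (Fin l) ℂ →ₗ[ℂ] S where
  toFun M := ∑ a, ∑ b, (α a * star (α b) * M a.2 b.2) • P a.1 b.1
  map_add' M N := by
    simp only [Matrix.add_apply, mul_add, add_smul, Finset.sum_add_distrib]
  map_smul' c M := by
    simp only [Matrix.smul_apply, smul_eq_mul, Finset.smul_sum, smul_smul, RingHom.id_apply]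
    refine Finset.sum_congr rfl fun i _ => Finset.sum_congr rfl fun j _ => ?_
    congr 1
    ring

/-- On rank-one blocks the map is a compression of `P`, by the contraction of `α` with the vectors.
-/
theorem isCP_ofMatrix {k : ℕ} {P : Matrix (Fin k) (Fin k) S} (hP : P ∈ cone k)
    (α : Fin k × Fin l → ℂ) : IsCP (ofMatrix P α) := by
  refine isCP_of_vecMulVec _ fun n v => ?_
  convert compress_mem (Matrix.of fun a i => ∑ j, α (i, j) * star (v a j)) hP using 1
  ext a b
  simp only [Matrix.of_apply, ofMatrix, LinearMap.coe_mk, AddHom.coe_mk, matrixCompress,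
    Matrix.vecMulVec_apply, Fintype.sum_prod_type, star_sum, star_mul', star_star, Pi.star_apply,
    Finset.sum_mul_sum, Finset.sum_smul]
  refine Finset.sum_congr rfl fun i _ => ?_
  rw [Finset.sum_comm]
  refine Finset.sum_congr rfl fun i' _ => Finset.sum_congr rfl fun j _ => Finset.sum_congr rfl fun j' _ => ?_
  congr 1
  ring

end CP

/-! ### Approximate factorization through matrix algebras -/

section Nuclear

variable {S : Type u} [AddCommGroup S] [Module ℂ S] [StarAddMonoid S] [StarModule ℂ S]
  [OperatorSystem S] {n m l : ℕ}

attribute [local instance] dualStarAddMonoid dualStarModule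

/-- The tensor represents the identity of `S`. Applying `ψ` to its second leg leaves a matrix `Y`
over `S`; once `Y` is positive, so is `φ` applied to `Y`, which is the required matrix up to
swapping tensor factors. -/
theorem sum_basis_tmul_coord_mem_minCone {δ : Module.Dual ℂ S} (hδ : IsDominating δ)
    {ι : Type*} [Fintype ι] [DecidableEq ι] (b : Module.Basis ι ℂ S) :
    letI := dualOperatorSystem hδ
    (Matrix.of fun _ _ => ∑ i, b i ⊗ₜ[ℂ] b.coord i) ∈ minCone S (Module.Dual ℂ S) 1 := by
  let := dualOperatorSystem hδ
  intro k m φ ψ hφ hψ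
  set Y : Matrix (Fin m) (Fin m) S := Matrix.of fun q q' => ∑ i, ψ (b.coord i) q q' • b i with hY
  have hYc : Y ∈ cone m := by
    refine mem_cone_iff.2 fun F hF => ?_
    -- The vector `∑ e_q ⊗ e_q` turns the positivity of `ψ` on `F` into that of the pairing of `F`
    -- with `Y`.
    have h := (mem_cone_matrix_iff.1 (hψ.map_mem_cone m F hF)).dotProduct_mulVec_nonneg
      fun x => if x.1 = x.2 then 1 else 0
    convert h using 1
    rw [pairing_apply]
    have : ∀ q q', F q q' (Y q q') = ψ (F q q') q q' := fun q q' => by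
      conv_rhs => rw [← b.sum_dual_apply_smul_coord (F q q')]
      simp only [hY, Matrix.of_apply, map_sum, map_smul, Matrix.sum_apply, Matrix.smul_apply,
        smul_eq_mul]
      exact Finset.sum_congr rfl fun i _ => mul_comm _ _
    simp only [this]
    simp [dotProduct, Matrix.mulVec, Fintype.sum_prod_type, Matrix.comp_apply]
  have h := (mem_cone_matrix_iff.1 (hφ.map_mem_cone m Y hYc)).submatrix
    fun x : Fin 1 × (Fin k × Fin m) => (x.2.2, x.2.1)
  convert h using 1
  ext ⟨a, p, q⟩ ⟨a', p', q'⟩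
  simp only [Matrix.comp_apply, Matrix.map_apply, Matrix.submatrix_apply, hY, Matrix.of_apply,
    map_sum, map_smul, tensorToMatrix, TensorProduct.lift.tmul, Matrix.sum_apply, Matrix.smul_apply,
    LinearMap.compl₁₂_apply, smul_eq_mul]
  refine Finset.sum_congr rfl fun i _ => ?_
  change φ (b i) p p' * ψ (b.coord i) q q' = _
  exact mul_comm _ _

theorem IsNuclear.exists_factorization [FiniteDimensional ℂ S] (hS : IsNuclear S) {δ : Module.Dual ℂ S}
    (hδ : IsDominating δ) {ε : ℝ} (hε : 0 < ε) :
    ∃ (l : ℕ) (φ : S →ₗ[ℂ] Matrix (Fin l) (Fin l) ℂ) (ψ : Matrix (Fin l) (Fin l) ℂ →ₗ[ℂ] S),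
      IsCP φ ∧ IsCP ψ ∧ ∀ x, ψ (φ x) = x + δ x • ((ε : ℂ) • unit) := by
  let := dualOperatorSystem hδ
  classical
  let b := Module.finBasis ℂ S
  have h := sum_basis_tmul_coord_mem_minCone hδ b
  rw [hS (Module.Dual ℂ S) 1] at h
  obtain ⟨k, l, P, Q, α, hP, hQ, he⟩ := h ε hε
  refine ⟨l, matrixOfDual Q, ofMatrix P (α 0), isCP_matrixOfDual hQ, isCP_ofMatrix hP _, fun x => ?_⟩
  -- Contract the tensor identity by `s ⊗ g ↦ g x • s`: the canonical tensor becomes `x`, and the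
  -- perturbation becomes `ε δ(x) 1`.
  have h0 := congrArg (TensorProduct.lift
    ((LinearMap.lsmul ℂ S).flip.compl₂ (LinearMap.applyₗ x : Module.Dual ℂ S →ₗ[ℂ] ℂ))) (congrFun (congrFun he 0) 0)
  simp only [Matrix.add_apply, Matrix.of_apply, map_add, map_sum, TensorProduct.lift.tmul,
    Matrix.smul_apply, map_smul, Matrix.diagonal_apply_eq, matrixCompress,
    Matrix.kroneckerMap_apply, LinearMap.compl₂_apply, LinearMap.flip_apply, LinearMap.lsmul_apply,
    LinearMap.applyₗ_apply_apply, Module.Basis.coord_apply, Module.Basis.sum_repr] at h0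
  rw [smul_comm, show (δ x) = (unit : Module.Dual ℂ S) x from rfl, h0]
  simp [ofMatrix, matrixOfDual, smul_smul]

theorem IsDominating.apply_unit_pos [Nontrivial S] {δ : Module.Dual ℂ S} (hδ : IsDominating δ) :
    0 < δ unit := by
  refine lt_of_le_of_ne (hδ.1 _ isPos_unit) fun h => ?_
  have hu : (unit : S) = 0 := hδ.eq_zero isPos_unit h.symm
  have hz : ∀ s : S, IsPos s → s = 0 := fun s hs => by
    obtain ⟨r, -, hr⟩ := exists_isPos_smul_unit_add (S := S) (s := -s)
      (by rw [star_neg, hs.star_eq])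
    rw [hu, smul_zero, zero_add] at hr
    exact congrFun (congrFun (eq_zero_of_mem_of_neg_mem hs hr) 0) 0
  obtain ⟨s, hs⟩ := exists_ne (0 : S)
  have hmem : s ∈ Submodule.span ℂ {s : S | IsPos s} := by rw [span_isPos]; trivial
  exact hs ((Submodule.mem_bot ℂ).1 (Submodule.span_le.2 (fun t ht => hz t ht) hmem))

/-- Approximate factorization of the identity through matrix algebras, with a unital first leg. -/
theorem IsNuclear.exists_unital_factorization [FiniteDimensional ℂ S] [Nontrivial S]
    (hS : IsNuclear S)
    {δ : Module.Dual ℂ S} (hδ : IsDominating δ) {ε : ℝ} (hε : 0 < ε) :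
    ∃ (l : ℕ) (φ : S →ₗ[ℂ] Matrix (Fin l) (Fin l) ℂ) (ψ : Matrix (Fin l) (Fin l) ℂ →ₗ[ℂ] S) (e : S),
      IsUCP φ ∧ IsCP ψ ∧ (∀ x, ψ (φ x) = x + δ x • e) ∧ IsPos e ∧ IsPos ((ε : ℂ) • unit - e) := by
  obtain ⟨l, φ, ψ, hφ, hψ, hψφ⟩ := hS.exists_factorization hδ (half_pos hε)
  have hψ1 : IsPos (ψ 1) := hψ.isPos (isPos_matrix_iff.2 Matrix.PosSemidef.one)
  obtain ⟨r, hr, hrp⟩ := exists_isPos_smul_unit_add (s := -ψ 1) (by rw [star_neg, hψ1.star_eq])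
  -- Since `ψ 1 ≤ r 1`, this choice gives `η ψ 1 ≤ (ε/2) 1`, the other half of the error budget.
  set η : ℝ := ε / 2 / r with hη
  have hη0 : 0 < η := by positivity
  -- Adding `η δ(·) 1` makes the image of the unit positive definite. Writing it as `C* C`,
  -- conjugation by `D = C⁻¹` normalizes the first leg, and conjugation by `C` in the second leg
  -- undoes this.
  set φ' : S →ₗ[ℂ] Matrix (Fin l) (Fin l) ℂ := φ + LinearMap.smulRight ((η : ℂ) • δ) 1 with hφ'
  have hφ'cp : IsCP φ' := hφ.add (isCP_smulRight_one fun s hs =>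
    mul_nonneg (Complex.zero_le_real.2 hη0.le) (hδ.1 s hs))
  have hq : (φ' unit).PosDef := by
    refine Matrix.PosDef.posSemidef_add (isPos_matrix_iff.1 (hφ.isPos isPos_unit)) ?_
    exact Matrix.PosDef.smul Matrix.PosDef.one (mul_pos (Complex.zero_lt_real.2 hη0) hδ.apply_unit_pos)
  obtain ⟨C, hC, hqC⟩ := hq.exists_isUnit_eq_conjTranspose_mul_self
  obtain ⟨D, hD1, hD2⟩ : ∃ D, C * D = 1 ∧ D * C = 1 := by
    obtain ⟨c, rfl⟩ := hC
    exact ⟨_, c.mul_inv, c.inv_mul⟩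
  have hD3 : D.conjTranspose * C.conjTranspose = 1 := by
    rw [← Matrix.conjTranspose_mul, hD1, Matrix.conjTranspose_one]
  have hD4 : C.conjTranspose * D.conjTranspose = 1 := by
    rw [← Matrix.conjTranspose_mul, hD2, Matrix.conjTranspose_one]
  refine ⟨l, (LinearMap.mulLeft ℂ D.conjTranspose ∘ₗ LinearMap.mulRight ℂ D) ∘ₗ φ',
    ψ ∘ₗ (LinearMap.mulLeft ℂ C.conjTranspose ∘ₗ LinearMap.mulRight ℂ C),
    ((ε / 2 : ℝ) : ℂ) • unit + (η : ℂ) • ψ 1, ⟨?_, (isCP_conj D).comp hφ'cp⟩, hψ.comp (isCP_conj C), fun x => ?_,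
    (isPos_unit.smul (half_pos hε).le).add (hψ1.smul hη0.le), ?_⟩
  · change D.conjTranspose * (φ' unit * D) = 1
    rw [hqC, Matrix.mul_assoc, hD1, Matrix.mul_one, hD3]
  · change ψ (C.conjTranspose * (D.conjTranspose * (φ' x * D) * C)) = _
    have : C.conjTranspose * (D.conjTranspose * (φ' x * D) * C) =
      (C.conjTranspose * D.conjTranspose) * φ' x * (D * C) := by simp only [Matrix.mul_assoc]
    rw [this, hD4, hD2, Matrix.one_mul, Matrix.mul_one, hφ', LinearMap.add_apply, map_add, hψφ]
    simp only [LinearMap.smulRight_apply, LinearMap.smul_apply, map_smul, smul_eq_mul]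
    module
  · convert hrp.smul hη0.le using 1
    have : (η : ℂ) * r = (ε / 2 : ℝ) := by
      rw [← Complex.ofReal_mul, hη, div_mul_cancel₀ _ hr.ne']
    rw [smul_add, smul_smul, this]
    push_cast
    module

end Nuclear

end OperatorSystem

theorem Complex.eq_zero_of_forall_nonneg {z : ℂ} {t : ℝ}
    (h : ∀ c : ℂ, 0 ≤ 2 * (c * z).re + ‖c‖ ^ 2 * t) : z = 0 := by
  by_contra hz
  have hpos : 0 < ‖z‖ ^ 2 := by positivity
  have ht : 0 < 1 + |t| := by positivity
  -- For this `c` the linear term is `-2‖z‖²/(1+|t|)`, and the quadratic term is at most half of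
  -- that in size.
  have h1 := h (-((1 + |t|)⁻¹ : ℝ) * star z)
  have e1 : (-((1 + |t|)⁻¹ : ℝ) * star z * z).re = -((1 + |t|)⁻¹ * ‖z‖ ^ 2) := by
    have : -(((1 + |t|)⁻¹ : ℝ) : ℂ) * star z * z = ((-((1 + |t|)⁻¹ * ‖z‖ ^ 2) : ℝ) : ℂ) := by
      rw [mul_assoc, RCLike.star_def, Complex.conj_mul']
      push_cast
      ring
    rw [this, Complex.ofReal_re]
  have e2 : ‖-(((1 + |t|)⁻¹ : ℝ) : ℂ) * star z‖ = (1 + |t|)⁻¹ * ‖z‖ := by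
    rw [norm_mul, norm_neg, norm_star, Complex.norm_real, Real.norm_of_nonneg (by positivity)]
  rw [e1, e2] at h1
  have h2 : (1 + |t|)⁻¹ * t ≤ 1 := by
    rw [inv_mul_le_iff₀ ht]
    linarith [le_abs_self t]
  have h3 : 0 < (1 + |t|)⁻¹ * ‖z‖ ^ 2 := by positivity
  nlinarith

namespace OperatorSystem

/-! ### The Choi–Effros product -/

section ChoiEffros

variable {S : Type u} [AddCommGroup S] [Module ℂ S] [StarAddMonoid S] [StarModule ℂ S]
  [OperatorSystem S]
variable {A : Type v} [Ring A] [StarRing A] [Algebra ℂ A]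

/-- Linear maps `φ : S → A` and `ψ : A → S` exhibiting the operator system `S` as a unital
completely positive retract of the `*`-algebra `A`, where complete positivity is expressed by means
of Gram matrices and compressions. -/
structure IsCPRetract (φ : S →ₗ[ℂ] A) (ψ : A →ₗ[ℂ] S) : Prop where
  map_unit : φ unit = 1
  retract : ∀ s, ψ (φ s) = s
  map_star : ∀ s, φ (star s) = star (φ s)
  map_star' : ∀ a, ψ (star a) = star (ψ a)
  gram_mem : ∀ (n : ℕ) (Y : Fin n → A), (Matrix.of fun i j => ψ (star (Y i) * Y j)) ∈ cone n
  conj_isPos : ∀ (n : ℕ) (X : Matrix (Fin n) (Fin n) S), X ∈ cone n → ∀ W : Fin n → A,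
    IsPos (ψ (∑ i, ∑ j, star (W i) * φ (X i j) * W j))

namespace IsCPRetract

variable {φ : S →ₗ[ℂ] A} {ψ : A →ₗ[ℂ] S} (h : IsCPRetract φ ψ)
include h

theorem isPos_star_mul_self (a : A) : IsPos (ψ (star a * a)) := h.gram_mem 1 fun _ => a

theorem map_one : ψ 1 = unit := by rw [← h.map_unit, h.retract]

theorem two_mem (a : A) :
    (Matrix.of fun i j => ψ (star ((![1, a] : Fin 2 → A) i) * (![1, a] : Fin 2 → A) j) :
      Matrix (Fin 2) (Fin 2) S) ∈ cone 2 :=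
  h.gram_mem 2 ![1, a]

/-- The image under `ψ` of the Gram matrix of `(1, a)` is positive; conjugating it by `(-φ (ψ a),
1)` leaves exactly this difference. -/
theorem schwarz (a : A) : IsPos (ψ (star a * a) - ψ (star (φ (ψ a)) * φ (ψ a))) := by
  have := h.conj_isPos 2 _ (h.two_mem a) ![-φ (ψ a), 1]
  convert this using 1
  simp only [Fin.sum_univ_two, Matrix.of_apply, Matrix.cons_val_zero, Matrix.cons_val_one, star_one,
    one_mul, mul_one, h.map_one, h.map_unit, h.map_star', h.map_star, star_neg, map_add, neg_mul,
    mul_neg, neg_neg, map_neg, h.retract]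
  abel

/-- In the Gram matrix of `(1, φ s)` a zero diagonal entry kills the off-diagonal one, which is `ψ
(φ s) = s`. -/
theorem eq_zero_of_star_mul_self (s : S) (hs : ψ (star (φ s) * φ s) = 0) : s = 0 := by
  have := eq_zero_of_diag_eq_zero (h.two_mem (φ s)) (i := 0) (j := 1) (by simpa using hs)
  simpa [h.retract] using this

variable [StarModule ℂ A]

/-- It suffices to treat `y = b - φ (ψ b)`, which `ψ` kills. In the Schwarz inequality for `φ t + c
• y` the terms in `φ t` alone cancel; what remains is linear plus quadratic in `c` and nonnegative
for every `c`, so the linear term vanishes. -/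
theorem map_mul_left (s : S) (b : A) : ψ (φ s * b) = ψ (φ s * φ (ψ b)) := by
  suffices H : ∀ (t : S) (y : A), ψ y = 0 → ψ (star (φ t) * y) = 0 by
    have := H (star s) (b - φ (ψ b)) (by rw [map_sub, h.retract, sub_self])
    rwa [h.map_star, star_star, mul_sub, map_sub, sub_eq_zero] at this
  intro t y hy
  refine eq_zero_of_forall_positiveFunctionals fun g hg => ?_
  refine Complex.eq_zero_of_forall_nonneg (t := (g (ψ (star y * y))).re) fun c => ?_
  have h1 := hg _ (h.schwarz (φ t + c • y))
  rw [map_add, map_smul, hy, smul_zero, add_zero, h.retract] at h1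
  have e1 : star (φ t + c • y) * (φ t + c • y) = star (φ t) * φ t + c • (star (φ t) * y) +
      star (c • (star (φ t) * y)) + (star c * c) • (star y * y) := by
    simp only [star_add, star_smul, star_mul, star_star, add_mul, mul_add, smul_mul_assoc,
      mul_smul_comm, smul_add, smul_smul, mul_comm (star c) c]
    abel
  rw [e1, map_add, map_add, map_add, h.map_star', map_smul, map_smul, add_sub_right_comm,
    add_sub_right_comm, add_sub_right_comm, sub_self, zero_add, map_add, map_add, positiveFunctional_star hg, map_smul,
    map_smul, RCLike.star_def, Complex.conj_mul', smul_eq_mul, smul_eq_mul] at h1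
  have h2 := (Complex.nonneg_iff.1 h1).1
  rw [Complex.add_re, Complex.add_re, Complex.conj_re, ← Complex.ofReal_pow,
    Complex.re_ofReal_mul] at h2
  linarith

theorem map_mul_right (b : A) (s : S) : ψ (b * φ s) = ψ (φ (ψ b) * φ s) := by
  have := congrArg star (h.map_mul_left (star s) (star b))
  rw [← h.map_star', ← h.map_star'] at this
  simpa [h.map_star, h.map_star'] using this

theorem mul_assoc (s t r : S) :
    ψ (φ (ψ (φ s * φ t)) * φ r) = ψ (φ s * φ (ψ (φ t * φ r))) := by
  rw [← h.map_mul_right, ← h.map_mul_left, _root_.mul_assoc]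

end IsCPRetract

end ChoiEffros

end OperatorSystem

/-! ### Finite-dimensional `*`-algebras with a faithful positive functional -/

section Wedderburn

variable {B : Type u} [Ring B]

section Column

variable [Algebra ℂ B]

/-- The element of an algebra isomorphic to `Π i, M_{k i}` whose `i`-th block has the vector `v` as
its first column, the other entries being zero. -/
def columnMap {d : ℕ} {k : Fin d → ℕ} [∀ i, NeZero (k i)]
    (e : B ≃ₐ[ℂ] ((i : Fin d) → Matrix (Fin (k i)) (Fin (k i)) ℂ)) (i : Fin d) :
    (Fin (k i) → ℂ) →ₗ[ℂ] B where
  toFun v := e.symm (Pi.single i (Matrix.vecMulVec v (Pi.single 0 1)))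
  map_add' v w := by rw [Matrix.add_vecMulVec, Pi.single_add, map_add]
  map_smul' c v := by rw [Matrix.smul_vecMulVec, Pi.single_smul, map_smul]; rfl

theorem mul_columnMap {d : ℕ} {k : Fin d → ℕ} [∀ i, NeZero (k i)]
    (e : B ≃ₐ[ℂ] ((i : Fin d) → Matrix (Fin (k i)) (Fin (k i)) ℂ)) (i : Fin d) (x : B)
    (v : Fin (k i) → ℂ) : x * columnMap e i v = columnMap e i ((e x i).mulVec v) := by
  apply e.injective
  simp only [columnMap, LinearMap.coe_mk, AddHom.coe_mk, map_mul, AlgEquiv.apply_symm_apply]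
  rw [← Matrix.mul_vecMulVec, Pi.single_mul_right]

theorem columnMap_injective {d : ℕ} {k : Fin d → ℕ} [∀ i, NeZero (k i)]
    (e : B ≃ₐ[ℂ] ((i : Fin d) → Matrix (Fin (k i)) (Fin (k i)) ℂ)) (i : Fin d) :
    Function.Injective (columnMap e i) := by
  intro v w h
  have h1 := congrFun (e.symm.injective h) i
  rw [Pi.single_eq_same, Pi.single_eq_same] at h1
  ext p
  simpa [Matrix.vecMulVec_apply] using congrFun (congrFun h1 p) 0

end Column

variable [StarRing B]

/-- For self-adjoint `z`, `z² = star z * z`, so `z² = 0` forces `z = 0`; exponents `2^k` let this be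
applied by repeated halving. -/
theorem IsSelfAdjoint.eq_zero_of_isNilpotent (h0 : ∀ b : B, star b * b = 0 → b = 0) {y : B}
    (hy : IsSelfAdjoint y) (hn : IsNilpotent y) : y = 0 := by
  have key : ∀ (k : ℕ) (z : B), IsSelfAdjoint z → z ^ 2 ^ k = 0 → z = 0 := by
    intro k
    induction k with
    | zero => intro z _ hz; simpa using hz
    | succ k ih =>
      intro z hz hzk
      refine h0 z ?_
      rw [hz.star_eq]
      refine ih (z * z) (by simpa [pow_two] using hz.pow 2) ?_
      rwa [← pow_two, ← pow_mul, ← pow_succ']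
  obtain ⟨n, hn⟩ := hn
  exact key n y hy (pow_eq_zero_of_le n.lt_two_pow_self.le hn)

/-- The radical is a nilpotent ideal, so each of its elements `x` has `star x * x` self-adjoint and
nilpotent. -/
theorem isSemisimpleRing_of_star_mul_self [IsArtinianRing B]
    (h0 : ∀ b : B, star b * b = 0 → b = 0) : IsSemisimpleRing B := by
  rw [IsArtinianRing.isSemisimpleRing_iff_jacobson, eq_bot_iff]
  intro x hx
  obtain ⟨n, hn⟩ := IsSemiprimaryRing.isNilpotent (R := B)
  refine h0 x (IsSelfAdjoint.eq_zero_of_isNilpotent h0 (.star_mul_self x) ⟨n, ?_⟩)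
  have := Ideal.pow_mem_pow (Ideal.mul_mem_left _ (star x) hx) n
  rwa [hn] at this

/-- A finite-dimensional complex `*`-algebra with a faithful positive functional is `*`-isomorphic
to a direct sum of matrix algebras. -/
theorem exists_star_algEquiv_pi_matrix [Algebra ℂ B] [StarModule ℂ B] [FiniteDimensional ℂ B]
    (δ : B →ₗ[ℂ] ℂ)
    (hstar : ∀ b, δ (star b) = star (δ b)) (hpos : ∀ b, 0 ≤ δ (star b * b))
    (h0 : ∀ b, δ (star b * b) = 0 → b = 0) :
    ∃ (d : ℕ) (k : Fin d → ℕ), (∀ i, 0 < k i) ∧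
      ∃ f : B ≃ₐ[ℂ] ((i : Fin d) → Matrix (Fin (k i)) (Fin (k i)) ℂ),
        ∀ b, f (star b) = star (f b) := by
  have : IsArtinianRing B := isArtinian_of_tower ℂ inferInstance
  have : IsSemisimpleRing B := isSemisimpleRing_of_star_mul_self fun b hb => h0 b (by rw [hb, map_zero])
  obtain ⟨d, k, hk, ⟨e⟩⟩ := IsSemisimpleRing.exists_algEquiv_pi_matrix_of_isAlgClosed ℂ B
  refine ⟨d, k, fun i => Nat.pos_of_neZero _, ?_⟩
  let u : ∀ i, Fin (k i) → Fin (k i) → ℂ := fun i p j => if p = j then 1 else 0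
  -- Gram matrix of the inner product `δ (star a * b)` on the first columns of block `i`, a left
  -- ideal on which `x` acts as the matrix `e x i`.
  let H : ∀ i, Matrix (Fin (k i)) (Fin (k i)) ℂ := fun i => Matrix.of fun p q =>
    δ (star (columnMap e i (u i p)) * columnMap e i (u i q))
  have hH : ∀ i v w, star v ⬝ᵥ (H i).mulVec w = δ (star (columnMap e i v) * columnMap e i w) := by
    intro i v w
    rw [LinearMap.pi_apply_eq_sum_univ (columnMap e i) v,
      LinearMap.pi_apply_eq_sum_univ (columnMap e i) w]
    simp only [star_sum, Finset.sum_mul, Finset.mul_sum, map_sum, star_smul, smul_mul_assoc,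
      mul_smul_comm, map_smul, dotProduct, Matrix.mulVec, Pi.star_apply, smul_eq_mul, H,
      Matrix.of_apply, u]
    rw [Finset.sum_comm]
    refine Finset.sum_congr rfl fun p _ => Finset.sum_congr rfl fun q _ => ?_
    ring
  have hHpos : ∀ i, (H i).PosDef := by
    intro i
    refine Matrix.PosDef.of_dotProduct_mulVec_pos ?_ fun v hv => ?_
    · ext p q
      simp only [Matrix.conjTranspose_apply, H, Matrix.of_apply]
      rw [← hstar, star_mul, star_star]
    · rw [hH]
      refine lt_of_le_of_ne (hpos _) fun h => hv ?_
      exact columnMap_injective e i ((h0 _ h.symm).trans (map_zero _).symm)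
  -- The star of `B` is the adjoint for `H i`, since left multiplication by `star x` is adjoint to
  -- that by `x`. With `H i = C* C`, conjugation by `C` turns it into the conjugate transpose.
  have hinv : ∀ i x, (e (star x) i).conjTranspose * H i = H i * e x i := by
    intro i x
    have h1 : ∀ v w, star v ⬝ᵥ ((e (star x) i).conjTranspose * H i).mulVec w =
        star v ⬝ᵥ (H i * e x i).mulVec w := fun v w => by
      rw [← Matrix.mulVec_mulVec, ← Matrix.mulVec_mulVec, Matrix.dotProduct_mulVec,
        ← Matrix.star_mulVec, hH, hH, ← mul_columnMap, ← mul_columnMap, star_mul, star_star, mul_assoc]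
    ext p q
    simpa using h1 (Pi.single p 1) (Pi.single q 1)
  choose C hC hHC using fun i => (hHpos i).exists_isUnit_eq_conjTranspose_mul_self
  choose c hc using hC
  let g : ((i : Fin d) → Matrix (Fin (k i)) (Fin (k i)) ℂ) ≃ₐ[ℂ]
      ((i : Fin d) → Matrix (Fin (k i)) (Fin (k i)) ℂ) :=
    AlgEquiv.piCongrRight fun i => MulSemiringAction.toAlgEquiv ℂ _ (ConjAct.toConjAct (c i))
  have hg : ∀ x i, (e.trans g) x i = C i * e x i * ((c i)⁻¹ : (Matrix (Fin (k i)) (Fin (k i)) ℂ)ˣ) := by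
    intro x i
    rw [← hc]
    rfl
  refine ⟨e.trans g, fun b => funext fun i => ?_⟩
  rw [Pi.star_apply, hg, hg, Matrix.star_eq_conjTranspose, Matrix.conjTranspose_mul,
    Matrix.conjTranspose_mul]
  have h1 := hinv i (star b)
  rw [star_star, hHC, ← hc] at h1
  rw [← hc]
  set cc := c i
  have h2 : (cc : Matrix (Fin (k i)) (Fin (k i)) ℂ) * (cc⁻¹ : (Matrix (Fin (k i)) (Fin (k i)) ℂ)ˣ) = 1 :=
    cc.mul_inv
  have h3 : ((cc⁻¹ : (Matrix (Fin (k i)) (Fin (k i)) ℂ)ˣ) : Matrix (Fin (k i)) (Fin (k i)) ℂ).conjTranspose *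
      (cc : Matrix (Fin (k i)) (Fin (k i)) ℂ).conjTranspose = 1 := by
    rw [← Matrix.conjTranspose_mul, h2, Matrix.conjTranspose_one]
  calc _ = ((cc⁻¹ : (Matrix (Fin (k i)) (Fin (k i)) ℂ)ˣ) : Matrix (Fin (k i)) (Fin (k i)) ℂ).conjTranspose *
      ((cc : Matrix (Fin (k i)) (Fin (k i)) ℂ).conjTranspose * cc * e (star b) i) *
        (cc⁻¹ : (Matrix (Fin (k i)) (Fin (k i)) ℂ)ˣ) := by
        simp only [← Matrix.mul_assoc, h3, Matrix.one_mul]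
    _ = _ := by
      rw [← h1]
      simp only [Matrix.mul_assoc, h2, Matrix.mul_one]

end Wedderburn

theorem conjTranspose_vecMulVec_mul_mul_vecMulVec {ι : Type*} [Fintype ι] [DecidableEq ι] (o : ι)
    (x y : ι → ℂ) (M : Matrix ι ι ℂ) :
    (Matrix.vecMulVec x (Pi.single o 1)).conjTranspose * M * Matrix.vecMulVec y (Pi.single o 1) =
      (star x ⬝ᵥ M.mulVec y) • Matrix.single o o 1 := by
  rw [Matrix.conjTranspose_vecMulVec, Matrix.vecMulVec_mul, Matrix.vecMulVec_mul_vecMulVec,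
    ← Matrix.dotProduct_mulVec, Matrix.single_eq_single_vecMulVec_single, Pi.star_single, star_one,
    Matrix.vecMulVec_smul]

/-! ### Transport of the matrix order to the direct sum of matrix algebras -/

namespace OperatorSystem

namespace IsCPRetract

variable {S : Type u} [AddCommGroup S] [Module ℂ S] [StarAddMonoid S] [StarModule ℂ S]
  [OperatorSystem S]
variable {A : Type v} [Ring A] [StarRing A] [Algebra ℂ A]
variable {φ : S →ₗ[ℂ] A} {ψ : A →ₗ[ℂ] S} (h : IsCPRetract φ ψ)
include h

/-- The Choi–Effros product `s ∘ t = ψ (φ s * φ t)` turns a finite-dimensional retract of a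
`*`-algebra into a direct sum of matrix algebras. -/
theorem exists_linearEquiv_pi_matrix [StarModule ℂ A] [FiniteDimensional ℂ S]
    {δ : Module.Dual ℂ S} (hδ : IsDominating δ) :
    ∃ (d : ℕ) (k : Fin d → ℕ), (∀ i, 0 < k i) ∧
      ∃ f : S ≃ₗ[ℂ] ((i : Fin d) → Matrix (Fin (k i)) (Fin (k i)) ℂ),
        f unit = 1 ∧ (∀ s t, f (ψ (φ s * φ t)) = f s * f t) ∧ ∀ s, f (star s) = star (f s) := by
  let R : Ring S :=
    { (inferInstance : AddCommGroup S) with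
      mul := fun s t => ψ (φ s * φ t)
      one := unit
      left_distrib := fun a b c => by
        change ψ (φ a * φ (b + c)) = ψ (φ a * φ b) + ψ (φ a * φ c)
        rw [map_add, mul_add, map_add]
      right_distrib := fun a b c => by
        change ψ (φ (a + b) * φ c) = ψ (φ a * φ c) + ψ (φ b * φ c)
        rw [map_add, add_mul, map_add]
      zero_mul := fun a => by
        change ψ (φ 0 * φ a) = 0
        rw [map_zero, zero_mul, map_zero]
      mul_zero := fun a => by
        change ψ (φ a * φ 0) = 0
        rw [map_zero, mul_zero, map_zero]
      mul_assoc := h.mul_assoc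
      one_mul := fun a => by
        change ψ (φ unit * φ a) = a
        rw [h.map_unit, one_mul, h.retract]
      mul_one := fun a => by
        change ψ (φ a * φ unit) = a
        rw [h.map_unit, mul_one, h.retract] }
  have hmul : ∀ s t : S, s * t = ψ (φ s * φ t) := fun _ _ => rfl
  let RS : StarRing S :=
    { (inferInstance : StarAddMonoid S) with
      star_mul := fun s t => by
        change star (ψ (φ s * φ t)) = ψ (φ (star t) * φ (star s))
        rw [← h.map_star', star_mul, h.map_star, h.map_star] }
  let RA : Algebra ℂ S := Algebra.ofModule
    (fun c s t => by rw [hmul, hmul, map_smul, smul_mul_assoc, map_smul])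
    (fun c s t => by rw [hmul, hmul, map_smul, mul_smul_comm, map_smul])
  have key : ∀ b : S, star b * b = ψ (star (φ b) * φ b) := fun b => by rw [hmul, h.map_star]
  obtain ⟨d, k, hk, f, hf⟩ := exists_star_algEquiv_pi_matrix (B := S) δ
    (positiveFunctional_star hδ.1)
    (fun b => by
      rw [key]
      exact hδ.1 _ (h.isPos_star_mul_self _))
    (fun b hb => by
      rw [key] at hb
      exact h.eq_zero_of_star_mul_self b (hδ.eq_zero (h.isPos_star_mul_self _) hb))
  exact ⟨d, k, hk, f.toLinearEquiv, f.map_one, fun s t => f.map_mul s t, hf⟩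

theorem unitallyCompletelyOrderIsomorphic {δ : Module.Dual ℂ S} (hδ : IsDominating δ)
    [StarModule ℂ A]
    {d : ℕ} {k : Fin d → ℕ} (hk : ∀ i, 0 < k i)
    (f : S ≃ₗ[ℂ] ((i : Fin d) → Matrix (Fin (k i)) (Fin (k i)) ℂ)) (f_unit : f unit = 1)
    (f_mul : ∀ s t, f (ψ (φ s * φ t)) = f s * f t) (f_star : ∀ s, f (star s) = star (f s)) :
    UnitallyCompletelyOrderIsomorphic S ((i : Fin d) → Matrix (Fin (k i)) (Fin (k i)) ℂ) := by
  have : ∀ i, NeZero (k i) := fun i => ⟨(hk i).ne'⟩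
  have hsymm : ∀ x y, f.symm (star x * y) = ψ (star (φ (f.symm x)) * φ (f.symm y)) := fun x y => by
    rw [LinearEquiv.symm_apply_eq, ← h.map_star, f_mul, f_star, f.apply_symm_apply,
      f.apply_symm_apply]
  refine ⟨f, ⟨f_unit, fun n X hX i => ?_⟩, ⟨?_, fun n X hX => ?_⟩⟩
  · refine mem_cone_matrix_iff.2 (Matrix.PosSemidef.of_dotProduct_mulVec_nonneg ?_ fun v => ?_)
    · refine isHermitian_comp.2 ?_
      ext p q : 1
      simp only [Matrix.conjTranspose_apply, Matrix.map_apply]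
      rw [← (isHermitian_of_mem hX).apply p q]
      exact congrFun (f_star (X q p)).symm i
    -- The corner unit `E` detects signs because `δ (f.symm E) > 0`. With the blocks of `v` as first
    -- columns of the `W a`, the sum of `star (W a) * f (X a b) * W b` is the quadratic form at `v`
    -- times `E`.
    · set E : (i : Fin d) → Matrix (Fin (k i)) (Fin (k i)) ℂ :=
        Pi.single i (Matrix.single 0 0 1) with hE
      have hEE : star E * E = E := by
        rw [hE, ← Pi.single_star, ← Pi.single_mul, Matrix.star_eq_conjTranspose, Matrix.conjTranspose_single]
        simp
      have hEpos : 0 < δ (f.symm E) := by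
        have hp : IsPos (f.symm E) := by
          rw [← hEE, hsymm]
          exact h.isPos_star_mul_self _
        refine lt_of_le_of_ne (hδ.1 _ hp) fun h0 => ?_
        have h1 := (f.symm.map_eq_zero_iff).1 (hδ.eq_zero hp h0.symm)
        have h2 := congrFun (congrFun (congrFun h1 i) 0) 0
        simp [hE] at h2
      let W : Fin n → (i : Fin d) → Matrix (Fin (k i)) (Fin (k i)) ℂ := fun a =>
        Pi.single i (Matrix.vecMulVec (fun p => v (a, p)) (Pi.single 0 1))
      have hW := hδ.1 _ (h.conj_isPos n X hX fun a => φ (f.symm (W a)))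
      have e : ψ (∑ a, ∑ b, star (φ (f.symm (W a))) * φ (X a b) * φ (f.symm (W b))) =
          (star v ⬝ᵥ (Matrix.comp _ _ _ _ ℂ ((X.map f).map fun s => s i)).mulVec v) • f.symm E := by
        rw [← f.symm.map_smul, LinearEquiv.eq_symm_apply]
        simp only [map_sum]
        have : ∀ a b, f (ψ (star (φ (f.symm (W a))) * φ (X a b) * φ (f.symm (W b)))) =
            star (W a) * f (X a b) * W b := fun a b => by
          rw [h.map_mul_right, f_mul, ← h.map_star, f_mul, f_star, f.apply_symm_apply,
            f.apply_symm_apply]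
        simp only [this]
        have hterm : ∀ a b, star (W a) * f (X a b) * W b = (star (fun p => v (a, p)) ⬝ᵥ
            (f (X a b) i).mulVec fun p => v (b, p)) • E := fun a b => by
          funext j
          rcases eq_or_ne j i with rfl | hj
          · simp only [W, hE, Pi.mul_apply, Pi.star_apply, Pi.single_eq_same, Pi.smul_apply]
            exact conjTranspose_vecMulVec_mul_mul_vecMulVec 0 _ _ _
          · simp [W, hE, Pi.single_eq_of_ne hj]
        simp only [hterm, ← Finset.sum_smul]
        congr 1
        simp only [dotProduct, Matrix.mulVec, Fintype.sum_prod_type, Finset.mul_sum]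
        refine Finset.sum_congr rfl fun a _ => ?_
        rw [Finset.sum_comm]
        rfl
      rw [e, map_smul, smul_eq_mul] at hW
      obtain ⟨h1, h2⟩ := Complex.pos_iff.1 hEpos
      obtain ⟨h3, h4⟩ := Complex.nonneg_iff.1 hW
      rw [Complex.mul_re, ← h2, mul_zero, sub_zero] at h3
      rw [Complex.mul_im, ← h2, mul_zero, zero_add] at h4
      exact Complex.nonneg_iff.2 ⟨nonneg_of_mul_nonneg_left h3 h1,
        ((mul_eq_zero.1 h4.symm).resolve_right h1.ne').symm⟩
  · change f.symm 1 = unit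
    rw [LinearEquiv.symm_apply_eq, f_unit]
  · choose B hB using fun i => Matrix.PosSemidef.exists_eq_conjTranspose_mul_self (mem_cone_matrix_iff.1 (hX i))
    -- Each row of `B i` is cut into pieces, each placed in row 0 of block `i`. The Gram matrices of
    -- these families sum to `X`, and `f.symm` sends a Gram matrix to one covered by `gram_mem`.
    let Y : (i : Fin d) → Fin n × Fin (k i) → Fin n → (i : Fin d) → Matrix (Fin (k i)) (Fin (k i)) ℂ :=
      fun i c a => Pi.single i (Matrix.vecMulVec (Pi.single 0 1) fun p => B i c (a, p))
    have e : X.map f.symm = ∑ i, ∑ c, Matrix.of fun a b =>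
        ψ (star (φ (f.symm (Y i c a))) * φ (f.symm (Y i c b))) := by
      ext a b
      simp only [Matrix.sum_apply, Matrix.of_apply, Matrix.map_apply, ← hsymm, ← map_sum]
      congr 1
      ext j p q
      have hj := congrFun (congrFun (hB j) (a, p)) (b, q)
      rw [Matrix.comp_apply, Matrix.map_apply, Matrix.mul_apply] at hj
      rw [Finset.sum_apply, Finset.sum_eq_single j, Finset.sum_apply, Matrix.sum_apply, hj]
      · refine Finset.sum_congr rfl fun c _ => ?_
        simp [Y, Matrix.mul_apply, Matrix.vecMulVec_apply, Pi.single_apply, Matrix.star_apply]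
      · intro i _ hi
        simp [Y, Pi.single_eq_of_ne hi.symm]
      · simp
    change X.map f.symm ∈ _
    rw [e]
    exact sum_mem _ _ fun i _ => sum_mem _ _ fun c _ => h.gram_mem n fun a => φ (f.symm (Y i c a))

end IsCPRetract

end OperatorSystem

/-! ### Bounded sequences and ultralimits -/

theorem exists_tendsto_ultrafilter_of_bounded {ι : Type*} (ω : Ultrafilter ι) {u : ι → ℂ} {C : ℝ}
    (h : ∀ n, ‖u n‖ ≤ C) : ∃ z, Filter.Tendsto u ω (nhds z) := by
  obtain ⟨z, -, hz⟩ := (isCompact_closedBall (0 : ℂ) C).ultrafilter_le_nhds (ω.map u) (by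
    rw [Filter.le_principal_iff]
    exact Filter.mem_map.2 (Filter.univ_mem' fun n => by simpa using h n))
  exact ⟨z, hz⟩

/-- A pointwise weakly bounded family of linear maps into a finite-dimensional space has a pointwise
weak limit along every ultrafilter. -/
theorem exists_linearMap_tendsto_ultrafilter {ι A S : Type*} [AddCommGroup A] [Module ℂ A]
    [AddCommGroup S] [Module ℂ S] [FiniteDimensional ℂ S] (ω : Ultrafilter ι) (T : ι → A →ₗ[ℂ] S)
    (hT : ∀ (a : A) (g : Module.Dual ℂ S), ∃ C : ℝ, ∀ n, ‖g (T n a)‖ ≤ C) :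
    ∃ L : A →ₗ[ℂ] S, ∀ (a : A) (g : Module.Dual ℂ S),
      Filter.Tendsto (fun n => g (T n a)) ω (nhds (g (L a))) := by
  let b := Module.finBasis ℂ S
  choose C hC using hT
  choose z hz using fun (a : A) (i : Fin (Module.finrank ℂ S)) =>
    exists_tendsto_ultrafilter_of_bounded ω (hC a (b.coord i))
  refine ⟨{ toFun := fun a => ∑ i, z a i • b i, map_add' := ?_, map_smul' := ?_ }, fun a g => ?_⟩
  · intro x y
    rw [← Finset.sum_add_distrib]
    refine Finset.sum_congr rfl fun i _ => ?_
    rw [← add_smul]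
    congr 1
    refine tendsto_nhds_unique (hz (x + y) i) ?_
    simpa only [map_add] using (hz x i).add (hz y i)
  · intro c x
    rw [RingHom.id_apply, Finset.smul_sum]
    refine Finset.sum_congr rfl fun i _ => ?_
    rw [smul_smul]
    congr 1
    refine tendsto_nhds_unique (hz (c • x) i) ?_
    simpa only [map_smul, smul_eq_mul] using (hz x i).const_mul c
  · simp only [LinearMap.coe_mk, AddHom.coe_mk, map_sum, map_smul, smul_eq_mul]
    have e : ∀ n, g (T n a) = ∑ i, b.coord i (T n a) * g (b i) := fun n => by
      have := congrArg g (b.sum_repr (T n a))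
      rw [map_sum] at this
      simpa only [map_smul, smul_eq_mul, Module.Basis.coord_apply] using this.symm
    simp only [e]
    exact tendsto_finsetSum _ fun i _ => (hz a i).mul_const _

open scoped Matrix.Norms.L2Operator in
/-- The `*`-algebra of norm bounded sequences of matrices of varying sizes. -/
def boundedMatrixSequences (l : ℕ → ℕ) :
    StarSubalgebra ℂ ((N : ℕ) → Matrix (Fin (l N)) (Fin (l N)) ℂ) where
  carrier := {a | ∃ C : ℝ, ∀ N, ‖a N‖ ≤ C}
  mul_mem' := by
    rintro a b ⟨C, hC⟩ ⟨D, hD⟩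
    exact ⟨C * D, fun N => (norm_mul_le _ _).trans
      (mul_le_mul (hC N) (hD N) (norm_nonneg _) ((norm_nonneg _).trans (hC N)))⟩
  add_mem' := by
    rintro a b ⟨C, hC⟩ ⟨D, hD⟩
    exact ⟨C + D, fun N => (norm_add_le _ _).trans (add_le_add (hC N) (hD N))⟩
  algebraMap_mem' c := ⟨‖c‖, fun N => by
    rw [Pi.algebraMap_apply, Matrix.algebraMap_eq_diagonal, Matrix.l2_opNorm_diagonal]
    exact pi_norm_const_le c⟩
  star_mem' := by
    rintro a ⟨C, hC⟩
    exact ⟨C, fun N => by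
      rw [Pi.star_apply, norm_star]
      exact hC N⟩

namespace OperatorSystem

variable {S : Type u} [AddCommGroup S] [Module ℂ S] [StarAddMonoid S] [StarModule ℂ S]
  [OperatorSystem S] {l n : ℕ}

open scoped Matrix.Norms.L2Operator MatrixOrder in
theorem posSemidef_smul_one_add_of_norm_le {b : Matrix (Fin l) (Fin l) ℂ} (hb : IsSelfAdjoint b) {C : ℝ}
    (hC : ‖b‖ ≤ C) : ((C : ℂ) • (1 : Matrix (Fin l) (Fin l) ℂ) + b).PosSemidef := by
  have h1 : -(algebraMap ℝ (Matrix (Fin l) (Fin l) ℂ)) ‖b‖ ≤ b :=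
    IsSelfAdjoint.neg_algebraMap_norm_le_self hb
  have h2 : 0 ≤ algebraMap ℝ (Matrix (Fin l) (Fin l) ℂ) ‖b‖ + b := by
    rwa [neg_le_iff_add_nonneg'] at h1
  have h3 := (Matrix.nonneg_iff_posSemidef.1 h2).add
    (Matrix.PosSemidef.smul (Matrix.PosSemidef.one (n := Fin l) (R := ℂ))
      (Complex.zero_le_real.2 (sub_nonneg.2 hC)))
  have e : (C : ℂ) • (1 : Matrix (Fin l) (Fin l) ℂ) + b =
      algebraMap ℝ (Matrix (Fin l) (Fin l) ℂ) ‖b‖ + b + ((C - ‖b‖ : ℝ) : ℂ) • 1 := by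
    rw [Algebra.algebraMap_eq_smul_one, ← Complex.coe_smul, Complex.ofReal_sub]
    module
  rw [e]
  exact h3

-- For self-adjoint `b`, both `C 1 ± b` are positive, so `g (Ψ (C 1 + b))` is at most `2CK δ(Ψ 1)`
-- in norm; removing `C g (Ψ 1)` brings the factor to 3. Real and imaginary parts double it to 6.
open scoped Matrix.Norms.L2Operator in
theorem IsCP.norm_apply_le {Ψ : Matrix (Fin l) (Fin l) ℂ →ₗ[ℂ] S} (hΨ : IsCP Ψ)
    {δ : Module.Dual ℂ S} (hδ : IsDominating δ) {g : Module.Dual ℂ S} {K : ℝ} (hK : 0 ≤ K)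
    (hg : ∀ s, IsPos s → ‖g s‖ ≤ K * (δ s).re) {a : Matrix (Fin l) (Fin l) ℂ} {C : ℝ} (hC : ‖a‖ ≤ C) :
    ‖g (Ψ a)‖ ≤ 6 * C * K * (δ (Ψ 1)).re := by
  have hC0 : 0 ≤ C := (norm_nonneg _).trans hC
  have hpos1 : IsPos (Ψ 1) := hΨ.isPos (isPos_matrix_iff.2 Matrix.PosSemidef.one)
  have key : ∀ b : Matrix (Fin l) (Fin l) ℂ, IsSelfAdjoint b → ‖b‖ ≤ C →
      ‖g (Ψ b)‖ ≤ 3 * C * K * (δ (Ψ 1)).re := by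
    intro b hb hbC
    have h1 := hΨ.isPos (isPos_matrix_iff.2 (posSemidef_smul_one_add_of_norm_le hb hbC))
    have h2 := hΨ.isPos (isPos_matrix_iff.2
      (posSemidef_smul_one_add_of_norm_le (C := C) hb.neg (by rwa [norm_neg])))
    have h3 := hg _ h1
    have h4 := (Complex.nonneg_iff.1 (hδ.1 _ h2)).1
    have h5 := hg _ hpos1
    simp only [map_add, map_smul, map_neg, smul_eq_mul, Complex.add_re, Complex.re_ofReal_mul,
      Complex.neg_re] at h3 h4
    have h6 : ‖g (Ψ b)‖ ≤ ‖(C : ℂ) * g (Ψ 1) + g (Ψ b)‖ + ‖(C : ℂ) * g (Ψ 1)‖ := by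
      simpa using norm_sub_le ((C : ℂ) * g (Ψ 1) + g (Ψ b)) ((C : ℂ) * g (Ψ 1))
    rw [norm_mul, Complex.norm_real, Real.norm_of_nonneg hC0] at h6
    have h7 := mul_le_mul_of_nonneg_left h5 hC0
    have h8 := mul_le_mul_of_nonneg_left h4 hK
    nlinarith
  have h1 := key _ (realPart a).2 ((realPart.norm_le a).trans hC)
  have h2 := key _ (imaginaryPart a).2 ((imaginaryPart.norm_le a).trans hC)
  have h3 : g (Ψ a) = g (Ψ (realPart a)) + Complex.I * g (Ψ (imaginaryPart a)) := by
    conv_lhs => rw [← realPart_add_I_smul_imaginaryPart a]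
    rw [map_add, map_add, map_smul, map_smul, smul_eq_mul]
  rw [h3]
  refine (norm_add_le _ _).trans ?_
  rw [norm_mul, Complex.norm_I, one_mul]
  linarith

-- If `0 ≤ s ≤ r 1`, every ucp map gives `0 ≤ Φ s ≤ r 1`, whatever its target size; positive
-- elements span.
open scoped Matrix.Norms.L2Operator MatrixOrder in
theorem exists_norm_ucp_apply_le (s : S) : ∃ C : ℝ, ∀ (l : ℕ) (Φ : S →ₗ[ℂ] Matrix (Fin l) (Fin l) ℂ),
    IsUCP Φ → ‖Φ s‖ ≤ C := by
  have hs : s ∈ Submodule.span ℂ {s : S | IsPos s} := by rw [span_isPos]; trivial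
  induction hs using Submodule.span_induction with
  | mem s hs =>
    obtain ⟨r, hr, h⟩ := exists_isPos_smul_unit_add (s := -s) (by rw [star_neg, IsPos.star_eq hs])
    refine ⟨r, fun l Φ hΦ => ?_⟩
    have h1 := isPos_matrix_iff.1 (hΦ.isCP.isPos hs)
    have h2 := isPos_matrix_iff.1 (hΦ.isCP.isPos h)
    rw [CStarAlgebra.norm_le_iff_le_algebraMap _ hr.le h1.nonneg, Algebra.algebraMap_eq_smul_one,
      ← sub_nonneg]
    convert h2.nonneg using 1
    rw [map_add, map_smul, map_neg, hΦ.map_unit, Complex.coe_smul, sub_eq_add_neg]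
    rfl
  | zero => exact ⟨0, fun l Φ _ => by simp⟩
  | add s t _ _ hs ht =>
    obtain ⟨C, hC⟩ := hs
    obtain ⟨D, hD⟩ := ht
    exact ⟨C + D, fun l Φ hΦ => by
      rw [map_add]
      exact (norm_add_le _ _).trans (add_le_add (hC l Φ hΦ) (hD l Φ hΦ))⟩
  | smul c s _ hs =>
    obtain ⟨C, hC⟩ := hs
    exact ⟨‖c‖ * C, fun l Φ hΦ => by
      rw [map_smul, norm_smul]
      exact mul_le_mul_of_nonneg_left (hC l Φ hΦ) (norm_nonneg _)⟩

theorem gram_mem_cone (Y : Fin n → Matrix (Fin l) (Fin l) ℂ) :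
    (Matrix.of fun i j => star (Y i) * Y j) ∈ cone (S := Matrix (Fin l) (Fin l) ℂ) n := by
  refine mem_cone_matrix_iff.2 ?_
  exact Matrix.posSemidef_conjTranspose_mul_self
    (Matrix.of fun (r : Fin l) (x : Fin n × Fin l) => Y x.1 r x.2)

theorem isPos_sum_star_mul_mul {Z : Matrix (Fin n) (Fin n) (Matrix (Fin l) (Fin l) ℂ)} (hZ : Z ∈ cone n)
    (W : Fin n → Matrix (Fin l) (Fin l) ℂ) : IsPos (∑ i, ∑ j, star (W i) * Z i j * W j) := by
  rw [isPos_matrix_iff]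
  convert (mem_cone_matrix_iff.1 hZ).conjTranspose_mul_mul_same
    (Matrix.of fun (x : Fin n × Fin l) (p : Fin l) => W x.1 x.2 p) using 1
  ext p q
  simp only [Matrix.sum_apply, Matrix.mul_apply, Matrix.conjTranspose_apply, Matrix.star_apply,
    Matrix.of_apply, Fintype.sum_prod_type, Matrix.comp_apply, Finset.sum_mul]
  rw [Finset.sum_comm]
  refine Finset.sum_congr rfl fun j _ => ?_
  rw [Finset.sum_comm]

open scoped Matrix.Norms.L2Operator in
/-- A finite-dimensional nuclear operator system is a retract of a `*`-algebra of bounded sequences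
of matrices. -/
theorem IsNuclear.exists_isCPRetract [FiniteDimensional ℂ S] [Nontrivial S] (hS : IsNuclear S)
    {δ : Module.Dual ℂ S} (hδ : IsDominating δ) :
    ∃ (l : ℕ → ℕ) (φ : S →ₗ[ℂ] boundedMatrixSequences l) (ψ : boundedMatrixSequences l →ₗ[ℂ] S),
      IsCPRetract φ ψ := by
  choose l Φ Ψ e hΦ hΨ hΨΦ he he' using fun N : ℕ =>
    hS.exists_unital_factorization hδ (Nat.one_div_pos_of_nat (α := ℝ) (n := N))
  have hδe : ∀ N : ℕ, (δ (e N)).re ≤ 1 / ((N : ℝ) + 1) * (δ unit).re := fun N => by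
    have := (Complex.nonneg_iff.1 (hδ.1 _ (he' N))).1
    rw [map_sub, map_smul, smul_eq_mul, Complex.sub_re, Complex.re_ofReal_mul] at this
    linarith
  have hu : 0 ≤ (δ unit).re := (Complex.nonneg_iff.1 (hδ.1 _ isPos_unit)).1
  have hΨ1 : ∀ N, Ψ N 1 = unit + δ unit • e N := fun N => by
    rw [← hΨΦ, (hΦ N).map_unit]
    rfl
  -- This bound, uniform in `N`, is what makes the maps `T N` pointwise weakly bounded, so that they
  -- have an ultralimit.
  have hδΨ1 : ∀ N, (δ (Ψ N 1)).re ≤ (δ unit).re + (δ unit).re * (δ unit).re := fun N => by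
    have him := (Complex.nonneg_iff.1 (hδ.1 _ (isPos_unit (S := S)))).2
    rw [hΨ1, map_add, map_smul, smul_eq_mul, Complex.add_re, Complex.mul_re, ← him, zero_mul,
      sub_zero]
    have h1 : 1 / ((N : ℝ) + 1) ≤ 1 := by
      rw [div_le_one (by positivity)]
      linarith [N.cast_nonneg (α := ℝ)]
    have h2 := (hδe N).trans (mul_le_of_le_one_left hu h1)
    linarith [mul_le_mul_of_nonneg_left h2 hu]
  let T : ℕ → boundedMatrixSequences l →ₗ[ℂ] S := fun N =>
    Ψ N ∘ₗ LinearMap.proj N ∘ₗ (boundedMatrixSequences l).toSubalgebra.toSubmodule.subtype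
  have hTapp : ∀ N a, T N a = Ψ N (a.1 N) := fun _ _ => rfl
  let ω := Filter.hyperfilter ℕ
  obtain ⟨ψ, hψ⟩ := exists_linearMap_tendsto_ultrafilter ω T fun a g => by
    obtain ⟨C, hC⟩ := a.2
    obtain ⟨K, hK, hg⟩ := hδ.exists_bound g
    refine ⟨6 * C * K * ((δ unit).re + (δ unit).re * (δ unit).re), fun N => ?_⟩
    refine ((hΨ N).norm_apply_le hδ hK hg (hC N)).trans
      (mul_le_mul_of_nonneg_left (hδΨ1 N) ?_)
    have := (norm_nonneg _).trans (hC N)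
    positivity
  let φ : S →ₗ[ℂ] boundedMatrixSequences l :=
    { toFun := fun s => ⟨fun N => Φ N s, by
        obtain ⟨C, hC⟩ := exists_norm_ucp_apply_le s
        exact ⟨C, fun N => hC _ _ (hΦ N)⟩⟩
      map_add' := fun s t => by ext N : 2; exact map_add _ _ _
      map_smul' := fun c s => by ext N : 2; exact map_smul _ _ _ }
  refine ⟨l, φ, ψ, ?_, fun s => ?_, fun s => ?_, fun a => ?_, fun n Y => ?_, fun n X hX W => ?_⟩
  · ext N : 2
    exact (hΦ N).map_unit
  · refine sub_eq_zero.1 (eq_zero_of_forall_positiveFunctionals fun g _ => ?_)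
    rw [map_sub, sub_eq_zero]
    refine tendsto_nhds_unique (hψ (φ s) g) ?_
    obtain ⟨K, hK, hg⟩ := hδ.exists_bound g
    have h1 : ∀ N, g (T N (φ s)) = g s + δ s * g (e N) := fun N => by
      rw [hTapp, show (φ s).1 N = Φ N s from rfl, hΨΦ, map_add, map_smul, smul_eq_mul]
    simp only [h1]
    -- The errors satisfy `0 ≤ e N ≤ 1/(N+1)` times the unit, so they vanish weakly and the limit
    -- `ψ` inverts `φ` exactly.
    have h2 : Filter.Tendsto (fun N => g (e N)) Filter.atTop (nhds 0) := by
      refine squeeze_zero_norm (a := fun N : ℕ => K * (δ unit).re * (1 / ((N : ℝ) + 1))) (fun N => ?_) ?_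
      · refine (hg _ (he N)).trans ?_
        linarith [mul_le_mul_of_nonneg_left (hδe N) hK]
      · simpa using tendsto_one_div_add_atTop_nhds_zero_nat.const_mul (K * (δ unit).re)
    have h3 := ((h2.mono_left Nat.hyperfilter_le_atTop).const_mul (δ s)).const_add (g s)
    simpa using h3
  · ext N : 2
    exact (hΦ N).isCP.map_star s
  · refine sub_eq_zero.1 (eq_zero_of_forall_positiveFunctionals fun g hg => ?_)
    rw [map_sub, sub_eq_zero, positiveFunctional_star hg]
    refine tendsto_nhds_unique (hψ (star a) g) ?_
    convert (hψ a g).star using 2 with N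
    rw [hTapp, hTapp, ← positiveFunctional_star hg, ← (hΨ N).map_star]
    rfl
  -- Membership in a cone is tested by functionals, so it survives weak limits.
  · refine mem_cone_iff.2 fun F hF => ?_
    have ht : Filter.Tendsto (fun N => pairing F (Matrix.of fun i j => T N (star (Y i) * Y j))) ω
        (nhds (pairing F (Matrix.of fun i j => ψ (star (Y i) * Y j)))) := by
      simp only [pairing_apply, Matrix.of_apply]
      exact tendsto_finsetSum _ fun i _ => tendsto_finsetSum _ fun j _ => hψ _ _
    exact ge_of_tendsto' ht fun N => hF _ (hΨ N n _ (gram_mem_cone fun i => (Y i).1 N))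
  · refine isPos_of_forall_positiveFunctionals fun g hg => ?_
    refine ge_of_tendsto' (hψ _ g) fun N => hg _ ?_
    have := (hΨ N).isPos (isPos_sum_star_mul_mul ((hΦ N).map_mem_cone n X hX) fun i => (W i).1 N)
    convert this using 2
    simp [φ, hTapp]

end OperatorSystem

theorem mainTheorem8 (S : Type u) [AddCommGroup S] [Module ℂ S] [StarAddMonoid S]
    [StarModule ℂ S] [OperatorSystem S] [FiniteDimensional ℂ S]
    (hS : OperatorSystem.IsNuclear S) :
    ∃ (d : ℕ) (k : Fin d → ℕ), (∀ i, 0 < k i) ∧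
      OperatorSystem.UnitallyCompletelyOrderIsomorphic S
        ((i : Fin d) → Matrix (Fin (k i)) (Fin (k i)) ℂ) := by
  obtain ⟨δ, hδ⟩ := OperatorSystem.exists_isDominating S
  rcases subsingleton_or_nontrivial S with h | h
  -- The zero space is the empty direct sum. It is treated apart because the normalization needs `δ
  -- unit > 0`.
  · let f : S ≃ₗ[ℂ] ((i : Fin 0) → Matrix (Fin (Fin.elim0 i)) (Fin (Fin.elim0 i)) ℂ) :=
      { (0 : S →ₗ[ℂ] _) with
        invFun := 0
        left_inv := fun _ => Subsingleton.elim _ _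
        right_inv := fun _ => Subsingleton.elim _ _ }
    refine ⟨0, fun i => i.elim0, fun i => i.elim0, f, ⟨Subsingleton.elim _ _, fun n X _ i => i.elim0⟩,
      ⟨Subsingleton.elim _ _, fun n X _ => ?_⟩⟩
    rw [Subsingleton.elim (X.map (f.symm : _ →ₗ[ℂ] S)) 0]
    exact OperatorSystem.zero_mem
  · obtain ⟨l, φ, ψ, hφψ⟩ := hS.exists_isCPRetract hδ
    obtain ⟨d, k, hk, f, h1, h2, h3⟩ := hφψ.exists_linearEquiv_pi_matrix hδ
    exact ⟨d, k, hk, hφψ.unitallyCompletelyOrderIsomorphic hδ hk f h1 h2 h3⟩
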